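/- **Setting.** Let $\mathbb R^3_1$ be $\mathbb R^3$ with the Minkowski metric $\langle u,w\rangle=-u_1w_1+u_2w_2+u_3w_3$ and $Q^2_+=\{p:\langle p,p\rangle=0,\ p_1>0\}$. All curves are smooth and defined on nonempty open intervals. A spacelike curve $X$ on $Q^2_+$ has the unit tangent field $T$, the associated curve $Y$ (the unique lightlike field with $\langle T,Y\rangle=0$ and $\langle X,Y\rangle=1$), and the curvature $k$ given by $dT/d\sigma=kX-Y$, where $\sigma$ is arc length. A family $\hat X^t$ of such curves solves the curvature flow (CF) if $\langle\partial_t\hat X^t,\hat Y^t\rangle=\hat k^t$, and the inverse curvature flow (ICF) if $\hat k^t\neq0$ and $\langle\partial_t\hat X^t,\hat Y^t\rangle=-1/\hat k^t$. An isometry of $Q^2_+$ is a linear map that preserves $\langle\cdot,\cdot\rangle$ and $Q^2_+$. The curve $X$ is a self-similar solution to the CF (ICF) if for some open interval $J\ni0$ the family $\hat X^t=f(t)M(t)X$, $t\in J$, solves the CF (ICF), where $f>0$ is smooth with $f(0)=1$ and the $M(t)$ are isometries of $Q^2_+$ depending smoothly on $t$ with $M(0)=\mathrm{Id}$; it is a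 soliton solution if moreover $f\equiv1$. A curve is trivial if its curvature is constant. For $v\in\mathbb R^3_1\setminus\{0\}$ and $c\in\mathbb R$, a $(v,c)$-curve is a spacelike curve $X:I\to Q^2_+$ parametrized by arc length $s$ with $k=c+\langle T,v\rangle$; it is maximal if it does not extend to a $(v,c)$-curve on a strictly larger open interval. Let $D_v$ be the set of $(\alpha,\tau,\eta)\in\mathbb R^3$ with $2\alpha\eta+\tau^2=\langle v,v\rangle$ and, in addition, $v_1\alpha<0$ if $v$ is timelike, and $(\alpha,\tau,\eta)\ne0$, $v_1\alpha\le0\le v_1\eta$ if $v$ is lightlike. Let $P_{v,c}$ be $D_v$ without the triples such that $(\tau,\eta)=(0,c\alpha)$ or $(\tau,\eta)=(-c,0)$. **Theorem.** Let $v\in\mathbb R^3_1\setminus\{0\}$ and $c\in\mathbb R$. 1. (A 2-parameter family.) $P_{v,c}$ is a nonempty regular surface in $\mathbb R^3$. For every $p\in P_{v,c}$ there is a maximal $(v,c)$-curve $X:I\to Q^2_+$ with $0\in I$ that is non-trivial and satisfies $(\langle X,v\rangle,\langle T,v\rangle,\langle Y,v\rangle)(0)=p$. Any other maximal $(v,c)$-curve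 $X':I'\to Q^2_+$ with $0\in I'$ and the same triple at $0$ has $I'=I$ and $X'=MX$ for an isometry $M$ of $Q^2_+$ with $Mv=v$. 2. Let $X:I\to Q^2_+$ be any non-trivial maximal $(v,c)$-curve. Then: * $X$ is a self-similar solution to the CF, and a soliton solution if $c=0$; moreover $(\langle X,v\rangle,\langle T,v\rangle,\langle Y,v\rangle)(s)\in P_{v,c}$ for all $s\in I$. * If $X$ is also a $(v',c)$-curve, then $v'=v$. So, for fixed $c$, these curves split into three disjoint classes, according to whether $v$ is timelike, lightlike or spacelike. * The curvature $k$ of $X$ has at most two zeros. * At each of the two ends of $I$, either $k$ is unbounded, or $k\to c$, or $k\to0$. * The set $\{s\in I:k(s)\neq0\}$ has at most three connected components, and on each of them $-Y$ is a self-similar solution to the ICF. -/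

import Mathlib

open Set Filter Topology
open scoped ContDiff Matrix

namespace LightCone

/-- The vector space underlying Minkowski 3-space; coordinate `0` is the time coordinate. -/
abbrev Mink3 : Type := Fin 3 → ℝ

/-- The Minkowski metric `-u₁v₁ + u₂v₂ + u₃v₃`. -/
def mink (u v : Mink3) : ℝ := -(u 0 * v 0) + u 1 * v 1 + u 2 * v 2

/-- The future light cone `Q²₊` (the vertex is excluded by the positivity of the time coordinate). -/
def coneFuture : Set Mink3 := {p | mink p p = 0 ∧ 0 < p 0}

/-- An open, nonempty interval of real numbers (possibly unbounded). -/
def IsOpenInterval (I : Set ℝ) : Prop := IsOpen I ∧ IsConnected I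

/-- The speed `√⟨X', X'⟩` of a spacelike curve. -/
noncomputable def speed (X : ℝ → Mink3) (s : ℝ) : ℝ := √(mink (deriv X s) (deriv X s))

/-- `X` is a smooth spacelike curve on `Q²₊`, defined on the interval `I` and with an arbitrary regular
parameter, `T` is its unit tangent field, `Y` is its associated curve (the unique lightlike field
orthogonal to `T` with `⟨X, Y⟩ = 1`) and `k` is its curvature: `dT/dσ = k X - Y`, where `σ` is arc length,
`dσ = speed ds`.  On `I`, the functions `T`, `Y` and `k` are determined by `X`. -/
structure IsFramedCurve (I : Set ℝ) (X T Y : ℝ → Mink3) (k : ℝ → ℝ) : Prop where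
  interval : IsOpenInterval I
  smooth : ContDiffOn ℝ ∞ X I
  mem_cone : ∀ s ∈ I, X s ∈ coneFuture
  spacelike : ∀ s ∈ I, 0 < mink (deriv X s) (deriv X s)
  tangent : ∀ s ∈ I, T s = (speed X s)⁻¹ • deriv X s
  lightlike : ∀ s ∈ I, mink (Y s) (Y s) = 0
  orthogonal : ∀ s ∈ I, mink (T s) (Y s) = 0
  normalized : ∀ s ∈ I, mink (X s) (Y s) = 1
  curvature : ∀ s ∈ I, deriv T s = speed X s • (k s • X s - Y s)

/-- The curve is parametrized by arc length. -/
def IsArcLength (I : Set ℝ) (X : ℝ → Mink3) : Prop :=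
  ∀ s ∈ I, mink (deriv X s) (deriv X s) = 1

/-- The curve with curvature `k` on `I` is a conic section of the cone (ellipse, parabola or hyperbola),
that is, its curvature is constant.  These are the trivial self-similar solutions. -/
def IsTrivialCurve (I : Set ℝ) (k : ℝ → ℝ) : Prop := ∃ κ : ℝ, ∀ s ∈ I, k s = κ

/-- An isometry of `Q²₊`: a linear map preserving the Minkowski metric and mapping `Q²₊` to itself.
(Such a map is bijective and then maps `Q²₊` onto itself.) -/
def IsConeIsometry (M : Matrix (Fin 3) (Fin 3) ℝ) : Prop :=
  (∀ u w : Mink3, mink (M *ᵥ u) (M *ᵥ w) = mink u w) ∧ ∀ p ∈ coneFuture, M *ᵥ p ∈ coneFuture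

/-- The family `Xhat t`, `t ∈ J`, of spacelike curves on `Q²₊` solves the curvature flow with initial
curve `X`. -/
def IsCFSolution (I J : Set ℝ) (X : ℝ → Mink3) (Xhat : ℝ → ℝ → Mink3) : Prop :=
  ContDiffOn ℝ ∞ (fun p : ℝ × ℝ => Xhat p.1 p.2) (J ×ˢ I) ∧
  (∀ s ∈ I, Xhat 0 s = X s) ∧
  ∀ t ∈ J, ∃ (T Y : ℝ → Mink3) (k : ℝ → ℝ), IsFramedCurve I (Xhat t) T Y k ∧
    ∀ s ∈ I, mink (deriv (fun r => Xhat r s) t) (Y s) = k s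

/-- The family `Xhat t`, `t ∈ J`, of spacelike curves on `Q²₊` with nowhere vanishing curvature solves
the inverse curvature flow with initial curve `X`. -/
def IsICFSolution (I J : Set ℝ) (X : ℝ → Mink3) (Xhat : ℝ → ℝ → Mink3) : Prop :=
  ContDiffOn ℝ ∞ (fun p : ℝ × ℝ => Xhat p.1 p.2) (J ×ˢ I) ∧
  (∀ s ∈ I, Xhat 0 s = X s) ∧
  ∀ t ∈ J, ∃ (T Y : ℝ → Mink3) (k : ℝ → ℝ), IsFramedCurve I (Xhat t) T Y k ∧
    ∀ s ∈ I, k s ≠ 0 ∧ mink (deriv (fun r => Xhat r s) t) (Y s) = -(1 / k s)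

/-- A smooth family of homotheties with factors `f t > 0` and isometries `M t` of `Q²₊`, for `t` in an
open interval `J` around `0`, that starts at the identity. -/
structure IsEvolution (J : Set ℝ) (f : ℝ → ℝ) (M : ℝ → Matrix (Fin 3) (Fin 3) ℝ) : Prop where
  interval : IsOpenInterval J
  zero_mem : (0 : ℝ) ∈ J
  smooth_f : ContDiffOn ℝ ∞ f J
  pos : ∀ t ∈ J, 0 < f t
  f_zero : f 0 = 1
  smooth_M : ∀ i j, ContDiffOn ℝ ∞ (fun t => M t i j) J
  isometry : ∀ t ∈ J, IsConeIsometry (M t)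
  M_zero : M 0 = 1

/-- Self-similar solution to the curvature flow. -/
def IsSelfSimilarCF (I : Set ℝ) (X : ℝ → Mink3) : Prop :=
  ∃ (J : Set ℝ) (f : ℝ → ℝ) (M : ℝ → Matrix (Fin 3) (Fin 3) ℝ), IsEvolution J f M ∧
    IsCFSolution I J X (fun t s => f t • (M t *ᵥ X s))

/-- Soliton solution to the curvature flow: a self-similar solution evolving by isometries only. -/
def IsSolitonCF (I : Set ℝ) (X : ℝ → Mink3) : Prop :=
  ∃ (J : Set ℝ) (f : ℝ → ℝ) (M : ℝ → Matrix (Fin 3) (Fin 3) ℝ), IsEvolution J f M ∧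
    (∀ t ∈ J, f t = 1) ∧ IsCFSolution I J X (fun t s => f t • (M t *ᵥ X s))

/-- Self-similar solution to the inverse curvature flow. -/
def IsSelfSimilarICF (I : Set ℝ) (X : ℝ → Mink3) : Prop :=
  ∃ (J : Set ℝ) (f : ℝ → ℝ) (M : ℝ → Matrix (Fin 3) (Fin 3) ℝ), IsEvolution J f M ∧
    IsICFSolution I J X (fun t s => f t • (M t *ᵥ X s))

/-- `X` is a spacelike curve on `Q²₊`, parametrized by arc length on `I`, whose curvature is
`k = c + ⟨T, v⟩`. -/
structure IsCurveFor (v : Mink3) (c : ℝ) (I : Set ℝ) (X T Y : ℝ → Mink3) (k : ℝ → ℝ) : Prop where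
  framed : IsFramedCurve I X T Y k
  arcLength : IsArcLength I X
  equation : ∀ s ∈ I, k s = c + mink (T s) v

/-- A curve as in `IsCurveFor` which is defined on its maximal interval: it has no extension to a
strictly larger open interval. -/
def IsMaximalCurveFor (v : Mink3) (c : ℝ) (I : Set ℝ) (X T Y : ℝ → Mink3) (k : ℝ → ℝ) : Prop :=
  IsCurveFor v c I X T Y k ∧
  ∀ (I' : Set ℝ) (X' T' Y' : ℝ → Mink3) (k' : ℝ → ℝ), IsCurveFor v c I' X' T' Y' k' →
    I ⊆ I' → (∀ s ∈ I, X' s = X s) → I' = I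

/-- The triple `(α, τ, η) = (⟨X, v⟩, ⟨T, v⟩, ⟨Y, v⟩)` at the parameter `s`. -/
def frameData (v : Mink3) (X T Y : ℝ → Mink3) (s : ℝ) : ℝ × ℝ × ℝ :=
  (mink (X s) v, mink (T s) v, mink (Y s) v)

/-- The surface of possible triples `(α, τ, η)`: in the quadric `2αη + τ² = ⟨v, v⟩`, a sheet of a two-sheeted
hyperboloid if `v` is timelike, one nappe of a cone without its vertex if `v` is lightlike, and the whole
one-sheeted hyperboloid if `v` is spacelike.  The sheet or nappe depends on the time orientation of
`v`; for `v 0 > 0` it is the one with `α ≤ 0` and `η ≥ 0`. -/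
def dataSurface (v : Mink3) : Set (ℝ × ℝ × ℝ) :=
  {p | 2 * p.1 * p.2.2 + p.2.1 ^ 2 = mink v v ∧
    ((mink v v < 0 ∧ v 0 * p.1 < 0) ∨
     (mink v v = 0 ∧ p ≠ 0 ∧ v 0 * p.1 ≤ 0 ∧ 0 ≤ v 0 * p.2.2) ∨
     0 < mink v v)}

/-- The triples on the surface other than those of the conic sections, which are the triples with
`τ = 0, η = cα` and the triples with `τ = -c, η = 0`. -/
def parameterSurface (v : Mink3) (c : ℝ) : Set (ℝ × ℝ × ℝ) :=
  {p | p ∈ dataSurface v ∧ ¬ (p.2.1 = 0 ∧ p.2.2 = c * p.1) ∧ ¬ (p.2.1 = -c ∧ p.2.2 = 0)}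

/-- Regular surfaces in 3-space: sets which near each of their points are parametrized by two real
parameters through a smooth injective immersion with continuous inverse. -/
def IsRegularSurface (S : Set (ℝ × ℝ × ℝ)) : Prop :=
  ∀ p ∈ S, ∃ (U : Set (ℝ × ℝ)) (V : Set (ℝ × ℝ × ℝ)) (φ : ℝ × ℝ → ℝ × ℝ × ℝ)
    (ψ : ℝ × ℝ × ℝ → ℝ × ℝ),
    IsOpen U ∧ IsOpen V ∧ p ∈ V ∧ φ '' U = V ∩ S ∧
    ContDiffOn ℝ ∞ φ U ∧ (∀ u ∈ U, Function.Injective (fderiv ℝ φ u)) ∧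
    ContinuousOn ψ (V ∩ S) ∧ ∀ u ∈ U, ψ (φ u) = u

/-- Behaviour at an end of the curve (described by a filter on the parameter interval): the curvature
is unbounded near the end, or tends to `c`, or tends to `0`. -/
def EndAlternative {I : Set ℝ} (c : ℝ) (k : ℝ → ℝ) (l : Filter I) : Prop :=
  (¬ ∃ B : ℝ, ∀ᶠ s : I in l, |k s| ≤ B) ∨
  Tendsto (fun s : I => k s) l (𝓝 c) ∨ Tendsto (fun s : I => k s) l (𝓝 0)

/-- The parameters at which the curvature does not vanish: the domain on which `-Y` is a spacelike
curve. -/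
def regularSet (I : Set ℝ) (k : ℝ → ℝ) : Set ℝ := {s | s ∈ I ∧ k s ≠ 0}

end LightCone

/-! In arc length the null frame satisfies `X' = T`, `T' = kX - Y`, `Y' = -kT` with `k = c + ⟨T,
v⟩`. This is an autonomous polynomial system, and its flow preserves the Gram matrix. Cone
isometries act transitively on null frames, and an isometry matching two frames with equal products
against `v` must fix `v`. Existence and uniqueness for ODEs then parametrize maximal curves modulo
the stabilizer of `v` by the triple `(α, τ, η) = (⟨X, v⟩, ⟨T, v⟩, ⟨Y, v⟩)` at one parameter
(`IsMaximalFrame.unique`, `exists_frame_of_mem_dataSurface`).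

The triple itself satisfies `α' = τ`, `τ' = kα - η`, `η' = -kτ` with `k = c + τ`, on the quadric
`2αη + τ² = ⟨v, v⟩`. Constant curvature corresponds exactly to the equilibria `τ = 0, η = cα` and
the invariant lines `τ = -c, η = 0`. Everything about the shape of `k` is read off this system.

Zeros: where `k = 0`, `k' = -η ≠ 0`, so zeros are simple and three of them would produce both a
negative and a positive gap. In each range of `c` and `⟨v, v⟩` one kind of gap contradicts the
monotonicity of `η`, of `α`, or of `η + cα`.

Ends: if `k` is bounded near an end, Gronwall and maximality make that end infinite. For `c = 0`,
`τ` is eventually monotone, and a nonzero limit would violate the quadric. For `c ≠ 0` the function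
`η + cα`, with derivative `-τ²`, decides: if it is bounded below, Barbalat's lemma gives `τ → 0`;
otherwise it tends to `-∞` and `k → 0`.

Self-similarity: a suitable sign of the Lorentzian cross product with `v` is an infinitesimal
isometry `A` with `⟨AX, Y⟩ = ⟨T, v⟩`. Taking `f = √(1 + 2ct)` and `M = exp(θA)` with `θ' = 1/f²`,
the normal speed of `f M X` is `(c + ⟨T, v⟩)/f² = k/f²`, which is its curvature. Where `k ≠ 0`, the
curve `-Y` has curvature `1/k` and associated curve `-X`, and the same `M` with the factor `1/f`
gives the inverse flow. -/

namespace LightCone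

/-! ### Autonomous ODEs: uniqueness, gluing, maximal solutions, extension. -/

section ODE

variable {E : Type*} [NormedAddCommGroup E] [NormedSpace ℝ E]

theorem IsOpenInterval.ordConnected {I : Set ℝ} (hI : IsOpenInterval I) : I.OrdConnected :=
  hI.2.isPreconnected.ordConnected

theorem IsOpenInterval.mk' {I : Set ℝ} (ho : IsOpen I) (hc : I.OrdConnected) (hn : I.Nonempty) :
    IsOpenInterval I :=
  ⟨ho, hn, hc.isPreconnected⟩

theorem isOpenInterval_Ioo {a b : ℝ} (h : a < b) : IsOpenInterval (Ioo a b) :=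
  ⟨isOpen_Ioo, isConnected_Ioo h⟩

theorem IsOpenInterval.inter {I J : Set ℝ} (hI : IsOpenInterval I) (hJ : IsOpenInterval J)
    {s : ℝ} (hsI : s ∈ I) (hsJ : s ∈ J) : IsOpenInterval (I ∩ J) :=
  .mk' (hI.1.inter hJ.1) (hI.ordConnected.inter hJ.ordConnected) ⟨s, hsI, hsJ⟩

theorem IsOpenInterval.union {I J : Set ℝ} (hI : IsOpenInterval I) (hJ : IsOpenInterval J)
    {s : ℝ} (hsI : s ∈ I) (hsJ : s ∈ J) : IsOpenInterval (I ∪ J) :=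
  ⟨hI.1.union hJ.1, hI.2.union ⟨s, hsI, hsJ⟩ hJ.2⟩

/-- `W` is an integral curve of the vector field `F` on the open interval `I`. -/
structure IsSolution (F : E → E) (I : Set ℝ) (W : ℝ → E) : Prop where
  interval : IsOpenInterval I
  hasDerivAt : ∀ s ∈ I, HasDerivAt W (F (W s)) s

variable {F : E → E} {I J : Set ℝ} {f g W : ℝ → E}

theorem IsSolution.mono (h : IsSolution F I W) (hJ : IsOpenInterval J) (hJI : J ⊆ I) :
    IsSolution F J W :=
  ⟨hJ, fun s hs => h.hasDerivAt s (hJI hs)⟩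

theorem IsSolution.congr (h : IsSolution F I f) (hfg : EqOn g f I) : IsSolution F I g :=
  ⟨h.interval, fun s hs => by
    rw [hfg hs]
    exact (h.hasDerivAt s hs).congr_of_eventuallyEq (hfg.eventuallyEq_of_mem (h.interval.1.mem_nhds hs))⟩

theorem IsSolution.continuousOn (h : IsSolution F I W) : ContinuousOn W I :=
  HasDerivAt.continuousOn h.hasDerivAt

/-- A `C¹` field is only locally Lipschitz, but it is Lipschitz on the compact union of the two
traces over a segment, and this is all that Gronwall uniqueness needs. -/
theorem IsSolution.eqOn (hF : ContDiff ℝ 1 F) (hf : IsSolution F I f) (hg : IsSolution F I g)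
    {s₀ : ℝ} (hs₀ : s₀ ∈ I) (h₀ : f s₀ = g s₀) : EqOn f g I := by
  have key : ∀ a b : ℝ, Icc a b ⊆ I → ∃ K, LipschitzOnWith K F (f '' Icc a b ∪ g '' Icc a b) :=
    fun a b hab => LocallyLipschitzOn.exists_lipschitzOnWith_of_compact
      ((isCompact_Icc.image_of_continuousOn (hf.continuousOn.mono hab)).union
        (isCompact_Icc.image_of_continuousOn (hg.continuousOn.mono hab)))
      (hF.locallyLipschitz.locallyLipschitzOn)
  intro t ht
  rcases le_total s₀ t with h | h
  · have hsub : Icc s₀ t ⊆ I := hf.interval.ordConnected.out hs₀ ht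
    obtain ⟨K, hK⟩ := key _ _ hsub
    exact ODE_solution_unique_of_mem_Icc_right (v := fun _ => F)
      (s := fun _ => f '' Icc s₀ t ∪ g '' Icc s₀ t) (fun _ _ => hK)
      (hf.continuousOn.mono hsub)
      (fun s hs => (hf.hasDerivAt s (hsub (Ico_subset_Icc_self hs))).hasDerivWithinAt)
      (fun s hs => Or.inl ⟨s, Ico_subset_Icc_self hs, rfl⟩)
      (hg.continuousOn.mono hsub)
      (fun s hs => (hg.hasDerivAt s (hsub (Ico_subset_Icc_self hs))).hasDerivWithinAt)
      (fun s hs => Or.inr ⟨s, Ico_subset_Icc_self hs, rfl⟩) h₀ ⟨h, le_rfl⟩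
  · have hsub : Icc t s₀ ⊆ I := hf.interval.ordConnected.out ht hs₀
    obtain ⟨K, hK⟩ := key _ _ hsub
    exact ODE_solution_unique_of_mem_Icc_left (v := fun _ => F)
      (s := fun _ => f '' Icc t s₀ ∪ g '' Icc t s₀) (fun _ _ => hK)
      (hf.continuousOn.mono hsub)
      (fun s hs => (hf.hasDerivAt s (hsub (Ioc_subset_Icc_self hs))).hasDerivWithinAt)
      (fun s hs => Or.inl ⟨s, Ioc_subset_Icc_self hs, rfl⟩)
      (hg.continuousOn.mono hsub)
      (fun s hs => (hg.hasDerivAt s (hsub (Ioc_subset_Icc_self hs))).hasDerivWithinAt)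
      (fun s hs => Or.inr ⟨s, Ioc_subset_Icc_self hs, rfl⟩) h₀ ⟨le_rfl, h⟩

theorem IsSolution.eqOn_inter (hF : ContDiff ℝ 1 F) (hf : IsSolution F I f) (hg : IsSolution F J g)
    {s₀ : ℝ} (hI : s₀ ∈ I) (hJ : s₀ ∈ J) (h₀ : f s₀ = g s₀) : EqOn f g (I ∩ J) :=
  have hIJ := hf.interval.inter hg.interval hI hJ
  (hf.mono hIJ inter_subset_left).eqOn hF (hg.mono hIJ inter_subset_right) ⟨hI, hJ⟩ h₀

theorem IsSolution.glue (hF : ContDiff ℝ 1 F) (hf : IsSolution F I f) (hg : IsSolution F J g)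
    {s₀ : ℝ} (hI : s₀ ∈ I) (hJ : s₀ ∈ J) (h₀ : f s₀ = g s₀) :
    ∃ W, IsSolution F (I ∪ J) W ∧ EqOn W f I ∧ EqOn W g J := by
  classical
  have hfI : EqOn (I.piecewise f g) f I := piecewise_eqOn I f g
  have hgJ : EqOn (I.piecewise f g) g J := by
    intro s hs
    by_cases hsI : s ∈ I
    · rw [hfI hsI, hf.eqOn_inter hF hg hI hJ h₀ ⟨hsI, hs⟩]
    · exact piecewise_eq_of_notMem I f g hsI
  refine ⟨I.piecewise f g, ⟨hf.interval.union hg.interval hI hJ, ?_⟩, hfI, hgJ⟩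
  rintro s (hs | hs)
  · exact (hf.congr hfI).hasDerivAt s hs
  · exact (hg.congr hgJ).hasDerivAt s hs

theorem exists_maximal_solution [CompleteSpace E] (hF : ContDiff ℝ 1 F) (W₀ : E) :
    ∃ I W, IsSolution F I W ∧ (0 : ℝ) ∈ I ∧ W 0 = W₀ ∧
      ∀ J g, IsSolution F J g → (0 : ℝ) ∈ J → g 0 = W₀ → J ⊆ I ∧ EqOn g W J := by
  classical
  let S : Set (Set ℝ) := {J | (0 : ℝ) ∈ J ∧ ∃ g, IsSolution F J g ∧ g 0 = W₀}
  have hex : ∀ s, ∃ w : E, ∀ J g, IsSolution F J g → (0 : ℝ) ∈ J → g 0 = W₀ → s ∈ J → g s = w := by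
    intro s
    by_cases h : ∃ J g, IsSolution F J g ∧ (0 : ℝ) ∈ J ∧ g 0 = W₀ ∧ s ∈ J
    · obtain ⟨J, g, hg, h0, hg0, hs⟩ := h
      exact ⟨g s, fun J' g' hg' h0' hg0' hs' =>
        hg'.eqOn_inter hF hg h0' h0 (hg0'.trans hg0.symm) ⟨hs', hs⟩⟩
    · push Not at h
      exact ⟨0, fun J g hg h0 hg0 hs => absurd hs (h J g hg h0 hg0)⟩
  choose W hW using hex
  have h0 : ∃ J ∈ S, True := by
    obtain ⟨α, hα, ε, hε, h⟩ :=
      (hF.contDiffAt (x := W₀)).exists_forall_mem_closedBall_exists_eq_forall_mem_Ioo_hasDerivAt₀ 0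
    exact ⟨Ioo (0 - ε) (0 + ε), ⟨⟨by linarith, by linarith⟩, α,
      ⟨isOpenInterval_Ioo (by linarith), h⟩, hα⟩, trivial⟩
  have hS0 : (0 : ℝ) ∈ ⋃₀ S := by
    obtain ⟨J, hJ, -⟩ := h0
    exact ⟨J, hJ, hJ.1⟩
  have hmax : ∀ J g, IsSolution F J g → (0 : ℝ) ∈ J → g 0 = W₀ → J ⊆ ⋃₀ S ∧ EqOn g W J :=
    fun J g hg h0 hg0 => ⟨subset_sUnion_of_mem ⟨h0, g, hg, hg0⟩, fun s hs => hW s J g hg h0 hg0 hs⟩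
  refine ⟨⋃₀ S, W, ⟨⟨isOpen_sUnion ?_, ⟨0, hS0⟩, isPreconnected_sUnion 0 S (fun J hJ => hJ.1) ?_⟩,
    ?_⟩, hS0, ?_, hmax⟩
  · rintro J ⟨-, g, hg, -⟩
    exact hg.interval.1
  · rintro J ⟨-, g, hg, -⟩
    exact hg.interval.2.isPreconnected
  · rintro s ⟨J, ⟨h0J, g, hg, hg0⟩, hs⟩
    exact (hg.congr (hmax J g hg h0J hg0).2.symm).hasDerivAt s hs
  · obtain ⟨J, ⟨h0J, g, hg, hg0⟩, -⟩ := h0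
    rw [← (hmax J g hg h0J hg0).2 h0J, hg0]

/-- Values along a sequence tending to the right end accumulate at some `x₀`. Near `x₀` solutions
exist for a uniform time `ε`, so a solution restarted less than `ε` before the end passes beyond it.
-/
theorem IsSolution.exists_extension [ProperSpace E] [CompleteSpace E] (hF : ContDiff ℝ 1 F)
    (h : IsSolution F I W) (hb : BddAbove I) {a R : ℝ} (ha : a ∈ I)
    (hR : ∀ s ∈ I, a ≤ s → ‖W s‖ ≤ R) :
    ∃ I' W', IsSolution F I' W' ∧ I ⊆ I' ∧ I' ≠ I ∧ EqOn W' W I := by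
  have hlub : IsLUB I (sSup I) := isLUB_csSup ⟨a, ha⟩ hb
  set b := sSup I with hbdef
  have hbI : b ∉ I := by
    intro hbI
    obtain ⟨ε, hε, hball⟩ := Metric.isOpen_iff.1 h.interval.1 b hbI
    have : b + ε / 2 ∈ I := hball (by simp [abs_of_pos hε, hε])
    linarith [hlub.1 this]
  obtain ⟨u, -, -, hu, huI⟩ := hlub.exists_seq_strictMono_tendsto_of_notMem hbI ⟨a, ha⟩
  have hab : a < b := lt_of_le_of_ne (hlub.1 ha) (fun e => hbI (e ▸ ha))
  have hev : ∀ᶠ n in atTop, W (u n) ∈ Metric.closedBall (0 : E) R := by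
    filter_upwards [hu.eventually (lt_mem_nhds hab)] with n hn
    simpa using hR _ (huI n) hn.le
  obtain ⟨x₀, -, φ, hφ, hlim⟩ :=
    (isCompact_closedBall (0 : E) R).tendsto_subseq' hev.frequently
  obtain ⟨r, hr, ε, hε, hsol⟩ :=
    (hF.contDiffAt (x := x₀)).exists_forall_mem_closedBall_exists_eq_forall_mem_Ioo_hasDerivAt 0
  obtain ⟨n, hn1, hn2⟩ := ((hlim.eventually (Metric.closedBall_mem_nhds x₀ hr)).and
    ((hu.comp hφ.tendsto_atTop).eventually (lt_mem_nhds (show b - ε < b by linarith)))).exists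
  simp only [Function.comp] at hn1 hn2
  set t := u (φ n) with ht
  have htI : t ∈ I := huI _
  obtain ⟨α, hα0, hα⟩ := hsol (W t) hn1
  have hg : IsSolution F (Ioo (t - ε) (t + ε)) (fun s => α (s - t)) := by
    refine ⟨isOpenInterval_Ioo (by linarith), fun s hs => ?_⟩
    exact (hα (s - t) ⟨by linarith [hs.1], by linarith [hs.2]⟩).comp_sub_const s t
  obtain ⟨W', hW', hWI, -⟩ := h.glue hF hg htI ⟨by linarith, by linarith⟩ (by simp [hα0])
  refine ⟨_, W', hW', subset_union_left, fun e => hbI ?_, hWI⟩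
  rw [← e]
  exact Or.inr ⟨by linarith [hlub.1 htI], by linarith⟩

/-- Bootstrapping: `W' = F ∘ W` is as smooth as `W`, so each order of smoothness yields the next. -/
theorem IsSolution.contDiffOn (hF : ContDiff ℝ ∞ F) (h : IsSolution F I W) :
    ContDiffOn ℝ ∞ W I := by
  rw [contDiffOn_infty]
  intro n
  induction n with
  | zero => exact contDiffOn_zero.2 h.continuousOn
  | succ n ih =>
    push_cast
    rw [contDiffOn_succ_iff_deriv_of_isOpen h.interval.1]
    refine ⟨fun s hs => (h.hasDerivAt s hs).differentiableAt.differentiableWithinAt, by simp, ?_⟩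
    exact ((hF.of_le (by exact_mod_cast le_top)).comp_contDiffOn ih).congr
      fun s hs => (h.hasDerivAt s hs).deriv

end ODE

/-! ### Linear algebra of null frames and of their products with `v`. -/

section Algebra

theorem mink_comm (u w : Mink3) : mink u w = mink w u := by simp only [mink]; ring

@[simp] theorem mink_add_left (u w z : Mink3) : mink (u + w) z = mink u z + mink w z := by
  simp only [mink, Pi.add_apply]; ring

@[simp] theorem mink_add_right (u w z : Mink3) : mink z (u + w) = mink z u + mink z w := by
  simp only [mink, Pi.add_apply]; ring

@[simp] theorem mink_sub_left (u w z : Mink3) : mink (u - w) z = mink u z - mink w z := by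
  simp only [mink, Pi.sub_apply]; ring

@[simp] theorem mink_sub_right (u w z : Mink3) : mink z (u - w) = mink z u - mink z w := by
  simp only [mink, Pi.sub_apply]; ring

@[simp] theorem mink_smul_left (a : ℝ) (u z : Mink3) : mink (a • u) z = a * mink u z := by
  simp only [mink, Pi.smul_apply, smul_eq_mul]; ring

@[simp] theorem mink_smul_right (a : ℝ) (u z : Mink3) : mink z (a • u) = a * mink z u := by
  simp only [mink, Pi.smul_apply, smul_eq_mul]; ring

@[simp] theorem mink_neg_left (u z : Mink3) : mink (-u) z = -mink u z := by
  simp only [mink, Pi.neg_apply]; ring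

@[simp] theorem mink_neg_right (u z : Mink3) : mink z (-u) = -mink z u := by
  simp only [mink, Pi.neg_apply]; ring

@[simp] theorem mink_zero_left (z : Mink3) : mink 0 z = 0 := by simp [mink]

theorem Mink3.ext' {u w : Mink3} (h0 : u 0 = w 0) (h1 : u 1 = w 1) (h2 : u 2 = w 2) : u = w := by
  funext i; fin_cases i <;> assumption

theorem eq_zero_of_null {p : Mink3} (h : mink p p = 0) (h0 : p 0 = 0) : p = 0 := by
  simp only [mink, h0] at h
  have h1 : p 1 = 0 := by nlinarith [mul_self_nonneg (p 1), mul_self_nonneg (p 2)]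
  have h2 : p 2 = 0 := by nlinarith [mul_self_nonneg (p 1), mul_self_nonneg (p 2)]
  exact Mink3.ext' h0 h1 h2

/-- Reversed Cauchy–Schwarz: the spatial product is strictly dominated by the product of the time
coordinates. -/
theorem mink_neg_of_timelike {p u : Mink3} (hp : p ∈ coneFuture) (hu : mink u u < 0)
    (hu0 : 0 < u 0) : mink p u < 0 := by
  obtain ⟨h, h0⟩ := hp
  simp only [mink] at *
  have hC : (p 1 * u 1 + p 2 * u 2) ^ 2 ≤ (p 0 * p 0) * (u 1 * u 1 + u 2 * u 2) := by
    nlinarith [sq_nonneg (p 1 * u 2 - p 2 * u 1)]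
  have hlt : (p 0 * p 0) * (u 1 * u 1 + u 2 * u 2) < (p 0 * u 0) ^ 2 := by
    nlinarith [mul_pos h0 h0]
  have := abs_lt.1 <| abs_lt_of_sq_lt_sq (hC.trans_lt hlt) (mul_pos h0 hu0).le
  linarith [this.2]

theorem mink_nonpos_of_null {p u : Mink3} (hp : p ∈ coneFuture) (hu : u ∈ coneFuture) :
    mink p u ≤ 0 := by
  obtain ⟨h, h0⟩ := hp
  obtain ⟨hu, hu0⟩ := hu
  simp only [mink] at *
  have hC : (p 1 * u 1 + p 2 * u 2) ^ 2 ≤ (p 0 * u 0) ^ 2 := by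
    have : (p 0 * u 0) ^ 2 = (p 1 * p 1 + p 2 * p 2) * (u 1 * u 1 + u 2 * u 2) := by
      rw [show p 1 * p 1 + p 2 * p 2 = p 0 * p 0 by linarith,
        show u 1 * u 1 + u 2 * u 2 = u 0 * u 0 by linarith]; ring
    nlinarith [sq_nonneg (p 1 * u 2 - p 2 * u 1)]
  have := abs_le.1 <| abs_le_of_sq_le_sq hC (mul_pos h0 hu0).le
  linarith [this.2]

/-- A null frame `(X, T, Y)`: the values at one parameter of a spacelike curve on the cone, its unit
tangent and its associated curve. -/
structure IsFrame (X T Y : Mink3) : Prop where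
  XX : mink X X = 0
  XT : mink X T = 0
  XY : mink X Y = 1
  TT : mink T T = 1
  TY : mink T Y = 0
  YY : mink Y Y = 0
  pos : 0 < X 0

variable {X T Y X' T' Y' : Mink3}

theorem IsFrame.TX (h : IsFrame X T Y) : mink T X = 0 := by rw [mink_comm, h.XT]
theorem IsFrame.YX (h : IsFrame X T Y) : mink Y X = 1 := by rw [mink_comm, h.XY]
theorem IsFrame.YT (h : IsFrame X T Y) : mink Y T = 0 := by rw [mink_comm, h.TY]
theorem IsFrame.mem_cone (h : IsFrame X T Y) : X ∈ coneFuture := ⟨h.XX, h.pos⟩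

theorem IsFrame.expand (h : IsFrame X T Y) (u : Mink3) :
    u = mink u Y • X + mink u T • T + mink u X • Y := by
  -- The Gram matrix pairs `X` with `Y` and `T` with itself, so the frame matrix is inverted by the
  -- index-lowered vectors in reverse order. Commuting the two factors turns the frame relations
  -- into the completeness relation.
  have hm : (!![X 0, X 1, X 2; T 0, T 1, T 2; Y 0, Y 1, Y 2] : Matrix (Fin 3) (Fin 3) ℝ) *
      !![-Y 0, -T 0, -X 0; Y 1, T 1, X 1; Y 2, T 2, X 2] = 1 := by
    have := h.XX; have := h.XT; have := h.XY; have := h.TX; have := h.TT; have := h.TY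
    have := h.YX; have := h.YT; have := h.YY
    simp only [mink] at *
    ext i j
    fin_cases i <;> fin_cases j <;> simp [Matrix.mul_apply, Fin.sum_univ_three] <;> linarith
  have hm' := mul_eq_one_comm.1 hm
  have e : ∀ i j, _ := fun i j => congrFun (congrFun hm' i) j
  have e00 := e 0 0; have e01 := e 0 1; have e02 := e 0 2
  have e10 := e 1 0; have e11 := e 1 1; have e12 := e 1 2
  have e20 := e 2 0; have e21 := e 2 1; have e22 := e 2 2
  simp [Matrix.mul_apply, Fin.sum_univ_three] at e00 e01 e02 e10 e11 e12 e20 e21 e22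
  refine Mink3.ext' ?_ ?_ ?_ <;> simp only [mink, Pi.add_apply, Pi.smul_apply, smul_eq_mul]
  · linear_combination -(u 0) * e00 - u 1 * e10 - u 2 * e20
  · linear_combination -(u 0) * e01 - u 1 * e11 - u 2 * e21
  · linear_combination -(u 0) * e02 - u 1 * e12 - u 2 * e22

theorem IsFrame.mink_expand (h : IsFrame X T Y) (u w : Mink3) :
    mink u w = mink Y u * mink X w + mink T u * mink T w + mink X u * mink Y w := by
  conv_lhs => rw [h.expand u]
  simp only [mink_add_left, mink_smul_left, mink_comm u]

theorem IsFrame.eq_zero (h : IsFrame X T Y) {u : Mink3} (hX : mink X u = 0) (hT : mink T u = 0)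
    (hY : mink Y u = 0) : u = 0 := by
  rw [h.expand u, mink_comm u, mink_comm u, mink_comm u, hX, hT, hY]; simp

theorem IsFrame.eq_assoc (h : IsFrame X T Y) {Z : Mink3} (hZ : mink Z Z = 0) (hT : mink T Z = 0)
    (hX : mink X Z = 1) : Z = Y := by
  have h1 := h.mink_expand Z Z
  rw [hZ, hT, hX] at h1
  rw [h.expand Z, mink_comm Z Y, mink_comm Z T, mink_comm Z X, hT, hX,
    show mink Y Z = 0 by linarith]
  simp

theorem IsFrame.timelike (h : IsFrame X T Y) : mink (X - Y) (X - Y) < 0 := by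
  simp [h.XX, h.XY, h.YX, h.YY]

theorem IsFrame.neg_Y (h : IsFrame X T Y) : -Y ∈ coneFuture := by
  refine ⟨by simp [h.YY], ?_⟩
  simp only [Pi.neg_apply]
  rcases lt_trichotomy (Y 0) 0 with h0 | h0 | h0
  · linarith
  · have := h.XY
    rw [eq_zero_of_null h.YY h0, mink_comm] at this
    simp at this
  · have := mink_nonpos_of_null h.mem_cone ⟨h.YY, h0⟩
    rw [h.XY] at this
    norm_num at this

/-- The duality between a curve and minus its associated curve: it exchanges `α` and `-η`, and it
reappears in the inverse flow. -/
theorem IsFrame.swap (h : IsFrame X T Y) : IsFrame (-Y) T (-X) :=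
  ⟨by simp [h.YY], by simp [h.YT], by simp [h.YX], h.TT, by simp [h.TX], by simp [h.XX], h.neg_Y.2⟩

theorem IsFrame.neg (h : IsFrame X T Y) : IsFrame X (-T) Y :=
  ⟨h.XX, by simp [h.XT], h.XY, by simp [h.TT], by simp [h.TY], h.YY, h.pos⟩

/-- The null rotations about `X`: they move `⟨T, v⟩` by `a⟨X, v⟩` while keeping `X`. -/
theorem IsFrame.shear (h : IsFrame X T Y) (a : ℝ) :
    IsFrame X (T + a • X) (Y - a • T - (a ^ 2 / 2) • X) := by
  constructor <;> simp [h.XX, h.XT, h.XY, h.TT, h.TY, h.YY, h.TX, h.YX, h.YT, h.pos]; ring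

theorem IsFrame.image (h : IsFrame X T Y) {M : Matrix (Fin 3) (Fin 3) ℝ} (hM : IsConeIsometry M) :
    IsFrame (M *ᵥ X) (M *ᵥ T) (M *ᵥ Y) :=
  ⟨by rw [hM.1, h.XX], by rw [hM.1, h.XT], by rw [hM.1, h.XY], by rw [hM.1, h.TT],
    by rw [hM.1, h.TY], by rw [hM.1, h.YY], (hM.2 _ h.mem_cone).2⟩

/-- A linear map that preserves the metric and maps a future timelike vector to a future timelike
vector is an isometry of the cone. -/
theorem isConeIsometry_of_timelike {M : Matrix (Fin 3) (Fin 3) ℝ}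
    (hM : ∀ u w : Mink3, mink (M *ᵥ u) (M *ᵥ w) = mink u w) {u : Mink3} (hu : mink u u < 0)
    (hu0 : 0 < u 0) (hMu : 0 < (M *ᵥ u) 0) : IsConeIsometry M := by
  refine ⟨hM, fun p hp => ⟨by rw [hM, hp.1], ?_⟩⟩
  have h1 : mink (M *ᵥ p) (M *ᵥ u) < 0 := by rw [hM]; exact mink_neg_of_timelike hp hu hu0
  rcases lt_trichotomy ((M *ᵥ p) 0) 0 with h0 | h0 | h0
  · have := mink_neg_of_timelike (p := -(M *ᵥ p)) (u := M *ᵥ u)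
      ⟨by simp only [mink_neg_left, mink_neg_right, neg_neg]; rw [hM, hp.1],
        by simp only [Pi.neg_apply]; linarith⟩ (by rwa [hM]) hMu
    rw [mink_neg_left] at this
    linarith
  · rw [eq_zero_of_null (by rw [hM, hp.1]) h0, mink_zero_left] at h1
    exact absurd h1 (lt_irrefl _)
  · exact h0

/-- Isometries act transitively on null frames. -/
theorem IsFrame.exists_isometry (h : IsFrame X T Y) (h' : IsFrame X' T' Y') :
    ∃ M : Matrix (Fin 3) (Fin 3) ℝ, IsConeIsometry M ∧
      ∀ u, M *ᵥ u = mink Y u • X' + mink T u • T' + mink X u • Y' := by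
  let low : Mink3 → Mink3 := fun u => ![-u 0, u 1, u 2]
  let M : Matrix (Fin 3) (Fin 3) ℝ :=
    Matrix.of fun j i => low Y i * X' j + low T i * T' j + low X i * Y' j
  have hM : ∀ u, M *ᵥ u = mink Y u • X' + mink T u • T' + mink X u • Y' := by
    intro u
    funext j
    simp [M, low, Matrix.mulVec, dotProduct, Fin.sum_univ_three, mink]
    ring
  refine ⟨M, ?_, hM⟩
  have hX := hM X
  have hY := hM Y
  rw [h.YX, h.TX, h.XX] at hX
  rw [h.YY, h.TY, h.XY] at hY
  refine isConeIsometry_of_timelike (u := X - Y) ?_ h.timelike ?_ ?_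
  · intro u w
    rw [hM u, hM w, h.mink_expand u w]
    simp [h'.XX, h'.XT, h'.XY, h'.TT, h'.TY, h'.YY, h'.TX, h'.YX, h'.YT]
    ring
  · have h1 := h.pos
    have h2 := h.neg_Y.2
    simp only [Pi.neg_apply, Pi.sub_apply] at *
    linarith
  · have h1 := h'.pos
    have h2 := h'.neg_Y.2
    rw [Matrix.mulVec_sub, hX, hY]
    simp at *
    linarith

theorem exists_frame_of_mem_cone (hX : X ∈ coneFuture) : ∃ T Y, IsFrame X T Y := by
  obtain ⟨h, h0⟩ := hX
  refine ⟨![0, -X 2 / X 0, X 1 / X 0], ![-1 / (2 * X 0), X 1 / (2 * X 0 ^ 2), X 2 / (2 * X 0 ^ 2)],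
    ?_⟩
  have hne := h0.ne'
  have hs : X 0 ^ 2 = X 1 ^ 2 + X 2 ^ 2 := by simp only [mink] at h; linarith
  constructor
  · exact h
  · simp [mink]; ring
  · simp [mink]; field_simp; linarith
  · simp [mink]; field_simp; linarith
  · simp [mink]; field_simp; ring
  · simp [mink]; field_simp; linarith
  · exact h0

theorem exists_mem_cone_mink_eq {v : Mink3} {a : ℝ} (ha : a ≠ 0)
    (h : (mink v v < 0 ∧ v 0 * a < 0) ∨ (mink v v = 0 ∧ v 0 * a < 0) ∨ 0 < mink v v) :
    ∃ X ∈ coneFuture, mink X v = a := by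
  -- The cone is invariant under positive scaling, so only the sign of `⟨X, v⟩` has to be right.
  suffices H : ∃ X ∈ coneFuture, 0 < mink X v * a by
    obtain ⟨X, hX, hXa⟩ := H
    have hne : mink X v ≠ 0 := fun e => by simp [e] at hXa
    have hpos : 0 < a / mink X v := by
      have : a / mink X v = mink X v * a / mink X v ^ 2 := by field_simp
      rw [this]; positivity
    refine ⟨(a / mink X v) • X, ⟨by simp [hX.1], ?_⟩, by simp [hne]⟩
    simpa using mul_pos hpos hX.2
  rcases h with ⟨hv, hva⟩ | ⟨hv, hva⟩ | hv
  · have hc : (![1, 1, 0] : Mink3) ∈ coneFuture := ⟨by simp [mink], by simp⟩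
    refine ⟨_, hc, ?_⟩
    rcases lt_or_gt_of_ne (show v 0 ≠ 0 from fun e => by simp [e] at hva) with h0 | h0
    · have h1 := mink_neg_of_timelike (u := -v) hc (by simpa using hv) (by simpa using h0)
      rw [mink_neg_right] at h1
      exact mul_pos (by linarith) (by nlinarith)
    · have h1 := mink_neg_of_timelike (u := v) hc hv h0
      exact mul_pos_of_neg_of_neg h1 (by nlinarith)
  · have hv' := hv
    simp only [mink] at hv'
    rcases lt_or_gt_of_ne (show v 0 ≠ 0 from fun e => by simp [e] at hva) with h0 | h0
    · refine ⟨![-v 0, v 1, v 2], ⟨by simp [mink]; linarith, by simpa using h0⟩, ?_⟩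
      simp only [mink, Matrix.cons_val]
      exact mul_pos (by nlinarith [mul_self_pos.2 h0.ne]) (by nlinarith)
    · refine ⟨![v 0, -v 1, -v 2], ⟨by simp [mink]; linarith, by simpa using h0⟩, ?_⟩
      simp only [mink, Matrix.cons_val]
      exact mul_pos_of_neg_of_neg (by nlinarith [mul_self_pos.2 h0.ne']) (by nlinarith)
  · simp only [mink] at hv
    set r := √(v 1 * v 1 + v 2 * v 2) with hr
    have hr2 : r * r = v 1 * v 1 + v 2 * v 2 :=
      Real.mul_self_sqrt (by nlinarith [mul_self_nonneg (v 1), mul_self_nonneg (v 2)])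
    have hrpos : 0 < r := Real.sqrt_pos.2 (by nlinarith [mul_self_nonneg (v 0)])
    have habs := abs_lt.1 <| abs_lt_of_sq_lt_sq (a := v 0) (b := r) (by nlinarith) hrpos.le
    rcases lt_or_gt_of_ne ha with h0 | h0
    · refine ⟨![r, -v 1, -v 2], ⟨by simp [mink]; linarith, by simpa using hrpos⟩, ?_⟩
      simp only [mink, Matrix.cons_val]
      exact mul_pos_of_neg_of_neg (by nlinarith [habs.1]) h0
    · refine ⟨![r, v 1, v 2], ⟨by simp [mink]; linarith, by simpa using hrpos⟩, ?_⟩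
      simp only [mink, Matrix.cons_val]
      exact mul_pos (by nlinarith [habs.2]) h0

theorem exists_mem_cone_mink_eq_zero {v : Mink3} (hv : 0 < mink v v) :
    ∃ X ∈ coneFuture, mink X v = 0 := by
  simp only [mink] at hv
  set b := √(v 1 * v 1 + v 2 * v 2 - v 0 * v 0) with hb
  have hb2 : b * b = v 1 * v 1 + v 2 * v 2 - v 0 * v 0 := Real.mul_self_sqrt (by linarith)
  -- With `w` the spatial part of `v`, this is `(|w|², v₀ w + b w^⊥)`, where `b² = ⟨v, v⟩` is
  -- exactly what makes it null.
  refine ⟨![v 1 * v 1 + v 2 * v 2, v 0 * v 1 - b * v 2, v 0 * v 2 + b * v 1], ⟨?_, ?_⟩, ?_⟩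
  · simp only [mink, Matrix.cons_val]
    linear_combination (v 1 * v 1 + v 2 * v 2) * hb2
  · simp only [Matrix.cons_val]
    nlinarith [mul_self_nonneg (v 0)]
  · simp only [mink, Matrix.cons_val]
    ring

theorem time_ne_zero_of_null {v : Mink3} (hv : v ≠ 0) (h : mink v v = 0) : v 0 ≠ 0 :=
  fun h0 => hv (eq_zero_of_null h h0)

theorem IsFrame.data_quadric (h : IsFrame X T Y) (v : Mink3) :
    2 * mink X v * mink Y v + mink T v ^ 2 = mink v v := by
  rw [h.mink_expand v v]; ring

/-- The sign conditions express that `X` and `-Y` both lie on the future cone, hence have a definite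
product sign with a timelike or lightlike `v`. -/
theorem IsFrame.data_mem (h : IsFrame X T Y) {v : Mink3} (hv : v ≠ 0) :
    (mink X v, mink T v, mink Y v) ∈ dataSurface v := by
  refine ⟨h.data_quadric v, ?_⟩
  rcases lt_trichotomy (mink v v) 0 with hq | hq | hq
  · refine Or.inl ⟨hq, ?_⟩
    have h0 : v 0 ≠ 0 := fun h0 => by
      simp only [mink, h0] at hq
      nlinarith [mul_self_nonneg (v 1), mul_self_nonneg (v 2)]
    rcases lt_or_gt_of_ne h0 with h0 | h0
    · have h1 := mink_neg_of_timelike (u := -v) h.mem_cone (by simpa using hq) (by simpa using h0)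
      rw [mink_neg_right] at h1
      exact mul_neg_of_neg_of_pos h0 (by linarith)
    · exact mul_neg_of_pos_of_neg h0 (mink_neg_of_timelike h.mem_cone hq h0)
  · refine Or.inr (Or.inl ⟨hq, ?_, ?_⟩)
    · intro e
      simp only [Prod.mk_eq_zero] at e
      exact hv (h.eq_zero e.1 e.2.1 e.2.2)
    · rcases lt_or_gt_of_ne (time_ne_zero_of_null hv hq) with h0 | h0
      · have hc : -v ∈ coneFuture := ⟨by simpa using hq, by simpa using h0⟩
        have h1 := mink_nonpos_of_null h.mem_cone hc
        have h2 := mink_nonpos_of_null h.neg_Y hc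
        simp only [mink_neg_left, mink_neg_right] at h1 h2
        exact ⟨mul_nonpos_of_nonpos_of_nonneg h0.le (by linarith),
          mul_nonneg_of_nonpos_of_nonpos h0.le (by linarith)⟩
      · have h1 := mink_nonpos_of_null h.mem_cone ⟨hq, h0⟩
        have h2 := mink_nonpos_of_null h.neg_Y ⟨hq, h0⟩
        simp only [mink_neg_left] at h2
        exact ⟨mul_nonpos_of_nonneg_of_nonpos h0.le h1, mul_nonneg h0.le (by linarith)⟩
  · exact Or.inr (Or.inr hq)

/-- Choose `X` with the right product, shear to correct `⟨T, v⟩`; then the quadric determines `⟨Y,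
v⟩` because `a ≠ 0`. -/
theorem exists_frame_of_ne_zero {v : Mink3} {a t n : ℝ} (ha : a ≠ 0)
    (hq : 2 * a * n + t ^ 2 = mink v v)
    (h : (mink v v < 0 ∧ v 0 * a < 0) ∨ (mink v v = 0 ∧ v 0 * a < 0) ∨ 0 < mink v v) :
    ∃ X T Y, IsFrame X T Y ∧ mink X v = a ∧ mink T v = t ∧ mink Y v = n := by
  obtain ⟨X, hX, hXa⟩ := exists_mem_cone_mink_eq ha h
  obtain ⟨T, Y, hF⟩ := exists_frame_of_mem_cone hX
  have hF' := hF.shear ((t - mink T v) / a)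
  have hT : mink (T + ((t - mink T v) / a) • X) v = t := by
    simp [hXa]; field_simp; ring
  refine ⟨_, _, _, hF', hXa, hT, ?_⟩
  have h1 := hF'.data_quadric v
  rw [hT, hXa, ← hq] at h1
  have h2 := add_right_cancel h1
  exact mul_left_cancel₀ (by simpa using ha) h2

theorem exists_frame_of_mem_dataSurface {v : Mink3} (hv : v ≠ 0) {p : ℝ × ℝ × ℝ}
    (hp : p ∈ dataSurface v) :
    ∃ X T Y, IsFrame X T Y ∧ mink X v = p.1 ∧ mink T v = p.2.1 ∧ mink Y v = p.2.2 := by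
  obtain ⟨a, t, n⟩ := p
  obtain ⟨hq, hc⟩ := hp
  simp only at hq hc ⊢
  by_cases ha : a = 0
  · by_cases hn : n = 0
    · have hpos : 0 < mink v v := by
        rcases hc with h | h | h
        · simp [ha] at h
        · obtain ⟨h1, h2, -⟩ := h
          refine absurd ?_ h2
          rw [h1, ha] at hq
          have : t = 0 := by nlinarith
          simp [ha, hn, this]
        · exact h
      obtain ⟨X, hX, hX0⟩ := exists_mem_cone_mink_eq_zero hpos
      obtain ⟨T₀, Y₀, hF₀⟩ := exists_frame_of_mem_cone hX
      have ht : t ≠ 0 := fun e => by simp [ha, e] at hq; linarith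
      -- When `α = η = 0`, the shear no longer moves `⟨T, v⟩`, but the quadric fixes it up to the
      -- sign of `T`. The shear then serves to kill `⟨Y, v⟩`.
      obtain ⟨T, Y, hF, hT⟩ : ∃ T Y, IsFrame X T Y ∧ mink T v = t := by
        have h1 := hF₀.data_quadric v
        rw [hX0, ← hq, ha] at h1
        rcases sq_eq_sq_iff_eq_or_eq_neg.1 (show mink T₀ v ^ 2 = t ^ 2 by linarith) with e | e
        · exact ⟨T₀, Y₀, hF₀, e⟩
        · exact ⟨-T₀, Y₀, hF₀.neg, by simp [e]⟩
      refine ⟨_, _, _, hF.shear (mink Y v / t), by rw [hX0, ha], by simp [hT, hX0], ?_⟩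
      simp [hT, hX0, hn]
      field_simp
      ring
    -- If only `α` vanishes, the problem is solved for the swapped frame, whose first entry is `-η ≠
    -- 0`.
    · obtain ⟨X, T, Y, hF, h1, h2, h3⟩ := exists_frame_of_ne_zero (v := v) (a := -n) (t := t)
        (n := -a) (neg_ne_zero.2 hn) (by linarith) (by
          rcases hc with h | h | h
          · simp [ha] at h
          · refine Or.inr (Or.inl ⟨h.1, ?_⟩)
            have := mul_ne_zero (time_ne_zero_of_null hv h.1) hn
            have := lt_of_le_of_ne h.2.2.2 this.symm
            linarith
          · exact Or.inr (Or.inr h))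
      exact ⟨_, _, _, hF.swap, by simp [h3], h2, by simp [h1]⟩
  · refine exists_frame_of_ne_zero ha hq ?_
    rcases hc with h | h | h
    · exact Or.inl h
    · exact Or.inr (Or.inl ⟨h.1, lt_of_le_of_ne h.2.2.1
        (mul_ne_zero (time_ne_zero_of_null hv h.1) ha)⟩)
    · exact Or.inr (Or.inr h)

end Algebra

/-! ### The frame equations and maximal curves. -/

section Curves

theorem hasDerivAt_mink {a b : ℝ → Mink3} {a' b' : Mink3} {s : ℝ} (ha : HasDerivAt a a' s)
    (hb : HasDerivAt b b' s) :
    HasDerivAt (fun s => mink (a s) (b s)) (mink a' (b s) + mink (a s) b') s := by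
  rw [hasDerivAt_pi] at ha hb
  have h := (((ha 0).mul (hb 0)).neg.add ((ha 1).mul (hb 1))).add ((ha 2).mul (hb 2))
  refine h.congr_deriv ?_
  simp only [mink]; ring

theorem hasDerivAt_mink_const {a : ℝ → Mink3} {a' : Mink3} {s : ℝ} (ha : HasDerivAt a a' s)
    (v : Mink3) : HasDerivAt (fun s => mink (a s) v) (mink a' v) s := by
  simpa [mink_comm _ (0 : Mink3)] using hasDerivAt_mink ha (hasDerivAt_const s v)

theorem contDiff_mink {n : WithTop ℕ∞} : ContDiff ℝ n fun p : Mink3 × Mink3 => mink p.1 p.2 := by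
  unfold mink
  fun_prop

variable {v : Mink3} {c : ℝ} {I I' : Set ℝ} {X T Y X' T' Y' : ℝ → Mink3} {k : ℝ → ℝ}

/-- The frame equations of a curve parametrized by arc length whose curvature is `c + ⟨T, v⟩`. -/
structure IsFrameSolution (v : Mink3) (c : ℝ) (I : Set ℝ) (X T Y : ℝ → Mink3) : Prop where
  interval : IsOpenInterval I
  frame : ∀ s ∈ I, IsFrame (X s) (T s) (Y s)
  dX : ∀ s ∈ I, HasDerivAt X (T s) s
  dT : ∀ s ∈ I, HasDerivAt T ((c + mink (T s) v) • X s - Y s) s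
  dY : ∀ s ∈ I, HasDerivAt Y (-(c + mink (T s) v) • T s) s

/-- The frame equations as an autonomous vector field. -/
def frameField (v : Mink3) (c : ℝ) (W : Mink3 × Mink3 × Mink3) : Mink3 × Mink3 × Mink3 :=
  (W.2.1, (c + mink W.2.1 v) • W.1 - W.2.2, -(c + mink W.2.1 v) • W.2.1)

theorem contDiff_frameField {n : WithTop ℕ∞} : ContDiff ℝ n (frameField v c) := by
  unfold frameField mink
  fun_prop

theorem IsFrameSolution.isSolution (h : IsFrameSolution v c I X T Y) :
    IsSolution (frameField v c) I fun s => (X s, T s, Y s) :=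
  ⟨h.interval, fun s hs => (h.dX s hs).prodMk ((h.dT s hs).prodMk (h.dY s hs))⟩

/-- The Gram matrix of a triple of vectors. -/
def gram (W : Mink3 × Mink3 × Mink3) : ℝ × ℝ × ℝ × ℝ × ℝ × ℝ :=
  (mink W.1 W.1, mink W.1 W.2.1, mink W.1 W.2.2, mink W.2.1 W.2.1, mink W.2.1 W.2.2,
    mink W.2.2 W.2.2)

/-- The frame equations together with the equations which they imply for the Gram matrix. -/
def gramField (v : Mink3) (c : ℝ)
    (Z : (ℝ × ℝ × ℝ × ℝ × ℝ × ℝ) × Mink3 × Mink3 × Mink3) :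
    (ℝ × ℝ × ℝ × ℝ × ℝ × ℝ) × Mink3 × Mink3 × Mink3 :=
  ((2 * Z.1.2.1, Z.1.2.2.2.1 + (c + mink Z.2.2.1 v) * Z.1.1 - Z.1.2.2.1,
    Z.1.2.2.2.2.1 - (c + mink Z.2.2.1 v) * Z.1.2.1,
    2 * ((c + mink Z.2.2.1 v) * Z.1.2.1 - Z.1.2.2.2.2.1),
    (c + mink Z.2.2.1 v) * Z.1.2.2.1 - Z.1.2.2.2.2.2 - (c + mink Z.2.2.1 v) * Z.1.2.2.2.1,
    -2 * (c + mink Z.2.2.1 v) * Z.1.2.2.2.2.1), frameField v c Z.2)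

theorem contDiff_gramField {n : WithTop ℕ∞} : ContDiff ℝ n (gramField v c) := by
  unfold gramField frameField mink
  fun_prop

theorem IsSolution.gram_eq {W : ℝ → Mink3 × Mink3 × Mink3}
    (h : IsSolution (frameField v c) I W) {s₀ : ℝ} (hs₀ : s₀ ∈ I)
    (h₀ : gram (W s₀) = (0, 0, 1, 1, 0, 0)) : ∀ s ∈ I, gram (W s) = (0, 0, 1, 1, 0, 0) := by
  -- The Gram entries satisfy a closed system along `W`, of which the constant null-frame matrix is
  -- another solution; uniqueness identifies the two.
  have h1 : IsSolution (gramField v c) I fun s => (gram (W s), W s) := by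
    refine ⟨h.interval, fun s hs => ?_⟩
    have hW := h.hasDerivAt s hs
    have dX : HasDerivAt (fun s => (W s).1) _ s := hW.fst
    have dT : HasDerivAt (fun s => (W s).2.1) _ s := hW.snd.fst
    have dY : HasDerivAt (fun s => (W s).2.2) _ s := hW.snd.snd
    refine HasDerivAt.prodMk ?_ hW
    refine ((hasDerivAt_mink dX dX).prodMk <| (hasDerivAt_mink dX dT).prodMk <|
      (hasDerivAt_mink dX dY).prodMk <| (hasDerivAt_mink dT dT).prodMk <|
      (hasDerivAt_mink dT dY).prodMk (hasDerivAt_mink dY dY)).congr_deriv ?_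
    simp only [frameField, gram, Prod.mk.injEq, mink_sub_left, mink_sub_right,
      mink_smul_left, mink_smul_right, mink_comm (W s).2.1 (W s).1, mink_comm (W s).2.2 (W s).2.1]
    refine ⟨?_, ?_, ?_, ?_, ?_, ?_⟩ <;> ring
  have h2 : IsSolution (gramField v c) I fun s => ((0, 0, 1, 1, 0, 0), W s) := by
    refine ⟨h.interval, fun s hs => ?_⟩
    refine ((hasDerivAt_const s _).prodMk (h.hasDerivAt s hs)).congr_deriv ?_
    simp [gramField, Prod.ext_iff]
  intro s hs
  exact congrArg Prod.fst (h1.eqOn contDiff_gramField h2 hs₀ (by simp [h₀]) hs)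

theorem IsFrame.gram_eq {X T Y : Mink3} (h : IsFrame X T Y) : gram (X, T, Y) = (0, 0, 1, 1, 0, 0) := by
  simp [gram, h.XX, h.XT, h.XY, h.TT, h.TY, h.YY]

theorem IsSolution.isFrameSolution {W : ℝ → Mink3 × Mink3 × Mink3}
    (h : IsSolution (frameField v c) I W) {s₀ : ℝ} (hs₀ : s₀ ∈ I)
    (h₀ : IsFrame (W s₀).1 (W s₀).2.1 (W s₀).2.2) :
    IsFrameSolution v c I (fun s => (W s).1) (fun s => (W s).2.1) fun s => (W s).2.2 := by
  have hg := h.gram_eq hs₀ h₀.gram_eq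
  simp only [gram, Prod.mk.injEq] at hg
  -- A null vector with zero time coordinate vanishes, contradicting `⟨X, Y⟩ = 1`. So the time
  -- coordinate keeps its sign along the interval.
  have hne : ∀ s ∈ I, (W s).1 0 ≠ 0 := by
    intro s hs h0
    have h1 := (hg s hs).2.2.1
    rw [eq_zero_of_null (hg s hs).1 h0] at h1
    simp at h1
  have hcont : ContinuousOn (fun s => (W s).1 0) I :=
    ((continuous_apply 0).comp continuous_fst).comp_continuousOn h.continuousOn
  refine ⟨h.interval, fun s hs => ?_, fun s hs => (h.hasDerivAt s hs).fst,
    fun s hs => (h.hasDerivAt s hs).snd.fst, fun s hs => (h.hasDerivAt s hs).snd.snd⟩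
  obtain ⟨h1, h2, h3, h4, h5, h6⟩ := hg s hs
  refine ⟨h1, h2, h3, h4, h5, h6, ?_⟩
  by_contra hneg
  obtain ⟨r, hr, hr0⟩ := h.interval.2.isPreconnected.intermediate_value hs hs₀ hcont
    ⟨not_lt.1 hneg, h₀.pos.le⟩
  exact hne r hr hr0

/-- Only the equation for `Y'` is not immediate. `Y = kX - T'` is smooth, and differentiating `⟨Y,
X⟩ = 1`, `⟨Y, T⟩ = 0`, `⟨Y, Y⟩ = 0` yields the components of `Y'` in the frame. -/
theorem IsCurveFor.isFrameSolution (h : IsCurveFor v c I X T Y k) :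
    IsFrameSolution v c I X T Y := by
  obtain ⟨⟨hI, hsm, hcone, -, hT, hYY, hTY, hXY, hk⟩, harc, heq⟩ := h
  have hn := fun s hs => hI.1.mem_nhds (x := s) hs
  have hsp : ∀ s ∈ I, speed X s = 1 := fun s hs => by rw [speed, harc s hs, Real.sqrt_one]
  have hTd : EqOn T (deriv X) I := fun s hs => by rw [hT s hs, hsp s hs, inv_one, one_smul]
  have dX : ∀ s ∈ I, HasDerivAt X (T s) s := fun s hs => by
    rw [hTd hs]
    exact ((hsm.contDiffAt (hn s hs)).differentiableAt (by simp)).hasDerivAt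
  have hTsm : ContDiffOn ℝ ∞ T I := (hsm.deriv_of_isOpen hI.1 (by simp)).congr hTd
  have hTk : ∀ s ∈ I, deriv T s = (c + mink (T s) v) • X s - Y s := fun s hs => by
    rw [hk s hs, hsp s hs, one_smul, heq s hs]
  have dT : ∀ s ∈ I, HasDerivAt T ((c + mink (T s) v) • X s - Y s) s := fun s hs => by
    rw [← hTk s hs]
    exact ((hTsm.contDiffAt (hn s hs)).differentiableAt (by simp)).hasDerivAt
  have hYsm : ContDiffOn ℝ ∞ Y I := by
    have h1 : ContDiffOn ℝ ∞ (fun s => (c + mink (T s) v) • X s - deriv T s) I :=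
      ((contDiffOn_const.add (contDiff_mink.comp_contDiffOn (hTsm.prodMk contDiffOn_const))).smul
        hsm).sub (hTsm.deriv_of_isOpen hI.1 (by simp))
    exact h1.congr fun s hs => by rw [hTk s hs]; abel
  have dY : ∀ s ∈ I, HasDerivAt Y (deriv Y s) s := fun s hs =>
    ((hYsm.contDiffAt (hn s hs)).differentiableAt (by simp)).hasDerivAt
  have hXT : ∀ s ∈ I, mink (X s) (T s) = 0 := fun s hs => by
    have h1 := hasDerivAt_mink (dX s hs) (dX s hs)
    have h2 : HasDerivAt (fun s => mink (X s) (X s)) 0 s :=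
      (hasDerivAt_const s 0).congr_of_eventuallyEq
        (eventually_of_mem (hn s hs) fun r hr => (hcone r hr).1)
    have := h1.unique h2
    rw [mink_comm (T s)] at this
    linarith
  have hfr : ∀ s ∈ I, IsFrame (X s) (T s) (Y s) := fun s hs =>
    ⟨(hcone s hs).1, hXT s hs, hXY s hs, by rw [hTd hs, harc s hs], hTY s hs, hYY s hs,
      (hcone s hs).2⟩
  refine ⟨hI, hfr, dX, dT, fun s hs => ?_⟩
  have hF := hfr s hs
  have const : ∀ {A B : ℝ → Mink3} {A' B' : Mink3} {e : ℝ}, HasDerivAt A A' s → HasDerivAt B B' s →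
      (∀ r ∈ I, mink (A r) (B r) = e) → mink A' (B s) + mink (A s) B' = 0 := by
    intro A B A' B' e hA hB hc
    exact (hasDerivAt_mink hA hB).unique ((hasDerivAt_const s e).congr_of_eventuallyEq
      (eventually_of_mem (hn s hs) hc))
  have h1 := const (dY s hs) (dX s hs) (e := 1) fun r hr => (hfr r hr).YX
  have h2 := const (dY s hs) (dT s hs) (e := 0) fun r hr => (hfr r hr).YT
  have h3 := const (dY s hs) (dY s hs) (e := 0) fun r hr => (hfr r hr).YY
  rw [mink_comm (Y s) (deriv Y s)] at h3
  simp only [mink_sub_right, mink_smul_right, hF.YX, hF.YY, hF.YT] at h1 h2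
  have h4 := hF.expand (deriv Y s)
  rw [show mink (deriv Y s) (Y s) = 0 by linarith, show mink (deriv Y s) (X s) = 0 by linarith,
    show mink (deriv Y s) (T s) = -(c + mink (T s) v) by linarith] at h4
  simp only [zero_smul, zero_add, add_zero] at h4
  rw [← h4]
  exact dY s hs

theorem IsFrameSolution.contDiffOn (h : IsFrameSolution v c I X T Y) :
    ContDiffOn ℝ ∞ X I ∧ ContDiffOn ℝ ∞ T I ∧ ContDiffOn ℝ ∞ Y I := by
  have h1 := h.isSolution.contDiffOn contDiff_frameField
  exact ⟨contDiff_fst.comp_contDiffOn h1, (contDiff_fst.comp contDiff_snd).comp_contDiffOn h1,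
    (contDiff_snd.comp contDiff_snd).comp_contDiffOn h1⟩

theorem IsFrameSolution.isCurveFor (h : IsFrameSolution v c I X T Y) :
    IsCurveFor v c I X T Y fun s => c + mink (T s) v := by
  have hd : ∀ s ∈ I, deriv X s = T s := fun s hs => (h.dX s hs).deriv
  have harc : IsArcLength I X := fun s hs => by rw [hd s hs, (h.frame s hs).TT]
  have hsp : ∀ s ∈ I, speed X s = 1 := fun s hs => by rw [speed, harc s hs, Real.sqrt_one]
  refine ⟨⟨h.interval, h.contDiffOn.1, fun s hs => (h.frame s hs).mem_cone,
    fun s hs => by rw [harc s hs]; exact one_pos, fun s hs => ?_, fun s hs => (h.frame s hs).YY,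
    fun s hs => (h.frame s hs).TY, fun s hs => (h.frame s hs).XY, fun s hs => ?_⟩, harc,
    fun s hs => rfl⟩
  · rw [hsp s hs, hd s hs, inv_one, one_smul]
  · rw [hsp s hs, (h.dT s hs).deriv, one_smul]

/-- On the interval of a curve, the frame is determined by the curve. -/
theorem IsFrameSolution.frame_eq (h : IsFrameSolution v c I X T Y)
    (h' : IsFrameSolution v c I' X' T' Y') {s : ℝ} {J : Set ℝ} (hJ : IsOpen J) (hs : s ∈ J)
    (hI : s ∈ I) (hI' : s ∈ I') (hX : EqOn X' X J) : T' s = T s ∧ Y' s = Y s := by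
  have hT : T' s = T s := (h'.dX s hI').unique
    ((h.dX s hI).congr_of_eventuallyEq (hX.eventuallyEq_of_mem (hJ.mem_nhds hs)))
  refine ⟨hT, (h.frame s hI).eq_assoc (h'.frame s hI').YY ?_ ?_⟩
  · rw [← hT, (h'.frame s hI').TY]
  · rw [← hX hs, (h'.frame s hI').XY]

/-- A solution of the frame equations which has no extension to a larger open interval. -/
structure IsMaximalFrame (v : Mink3) (c : ℝ) (I : Set ℝ) (X T Y : ℝ → Mink3) : Prop where
  sol : IsFrameSolution v c I X T Y
  maximal : ∀ (I' : Set ℝ) (X' T' Y' : ℝ → Mink3), IsFrameSolution v c I' X' T' Y' → I ⊆ I' →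
    EqOn X' X I → I' = I

theorem IsMaximalCurveFor.isMaximalFrame (h : IsMaximalCurveFor v c I X T Y k) :
    IsMaximalFrame v c I X T Y :=
  ⟨h.1.isFrameSolution, fun I' X' T' Y' h' hI hX => h.2 I' X' T' Y' _ h'.isCurveFor hI hX⟩

theorem IsMaximalFrame.isMaximalCurveFor (h : IsMaximalFrame v c I X T Y) :
    IsMaximalCurveFor v c I X T Y fun s => c + mink (T s) v :=
  ⟨h.sol.isCurveFor, fun I' X' T' Y' _ h' hI hX => h.maximal I' X' T' Y' h'.isFrameSolution hI hX⟩

/-- Maximality as an ODE solution implies maximality as a curve, since an extension of the curve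
alone automatically extends the frame. -/
theorem exists_maximal_frame (v : Mink3) (c : ℝ) {X₀ T₀ Y₀ : Mink3} (h : IsFrame X₀ T₀ Y₀) :
    ∃ I X T Y, (0 : ℝ) ∈ I ∧ IsMaximalFrame v c I X T Y ∧ X 0 = X₀ ∧ T 0 = T₀ ∧ Y 0 = Y₀ := by
  obtain ⟨I, W, hW, h0, hW0, hmax⟩ :=
    exists_maximal_solution (contDiff_frameField (v := v) (c := c)) (X₀, T₀, Y₀)
  have hsol := hW.isFrameSolution h0 (by rw [hW0]; exact h)
  refine ⟨I, _, _, _, h0, ⟨hsol, ?_⟩, by rw [hW0], by rw [hW0], by rw [hW0]⟩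
  intro I' X' T' Y' h' hI hX
  obtain ⟨h1, h2⟩ := hsol.frame_eq h' hW.interval.1 h0 h0 (hI h0) hX
  refine Subset.antisymm (hmax I' _ h'.isSolution (hI h0) ?_).1 hI
  simp only [h1, h2, hX h0, hW0]

theorem IsMaximalFrame.eqOn (h : IsMaximalFrame v c I X T Y)
    (h' : IsFrameSolution v c I' X' T' Y') {s₀ : ℝ} (hs : s₀ ∈ I) (hs' : s₀ ∈ I')
    (hX : X' s₀ = X s₀) (hT : T' s₀ = T s₀) (hY : Y' s₀ = Y s₀) : I' ⊆ I ∧ EqOn X' X I' := by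
  obtain ⟨W, hW, hWI, hWI'⟩ := h.sol.isSolution.glue contDiff_frameField h'.isSolution hs hs'
    (by simp [hX, hT, hY])
  have hWf := hW.isFrameSolution (Or.inl hs) (by rw [hWI hs]; exact h.sol.frame s₀ hs)
  have hU := h.maximal _ _ _ _ hWf subset_union_left fun s hs => by simp only [hWI hs]
  have hsub : I' ⊆ I := union_eq_left.1 hU
  refine ⟨hsub, fun s hs => ?_⟩
  have h1 := hWI' hs
  rw [hWI (hsub hs)] at h1
  exact (congrArg Prod.fst h1).symm

theorem hasDerivAt_mulVec (M : Matrix (Fin 3) (Fin 3) ℝ) {f : ℝ → Mink3} {f' : Mink3} {s : ℝ}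
    (h : HasDerivAt f f' s) : HasDerivAt (fun s => M *ᵥ f s) (M *ᵥ f') s :=
  (M.mulVecLin.toContinuousLinearMap.hasFDerivAt).comp_hasDerivAt s h

theorem IsFrameSolution.image (h : IsFrameSolution v c I X T Y) {M : Matrix (Fin 3) (Fin 3) ℝ}
    (hM : IsConeIsometry M) (hv : M *ᵥ v = v) :
    IsFrameSolution v c I (fun s => M *ᵥ X s) (fun s => M *ᵥ T s) fun s => M *ᵥ Y s := by
  have hk : ∀ s, mink (M *ᵥ T s) v = mink (T s) v := fun s => by
    conv_lhs => rw [← hv]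
    exact hM.1 _ _
  refine ⟨h.interval, fun s hs => (h.frame s hs).image hM,
    fun s hs => hasDerivAt_mulVec M (h.dX s hs), fun s hs => ?_, fun s hs => ?_⟩
  · rw [hk]
    simpa only [Matrix.mulVec_sub, Matrix.mulVec_smul] using hasDerivAt_mulVec M (h.dT s hs)
  · rw [hk]
    simpa only [Matrix.mulVec_smul] using hasDerivAt_mulVec M (h.dY s hs)

/-- A maximal curve is determined by its data at one parameter, up to isometries that fix `v`. -/
theorem IsMaximalFrame.unique (h : IsMaximalFrame v c I X T Y) (h' : IsMaximalFrame v c I' X' T' Y')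
    {s₀ : ℝ} (hs : s₀ ∈ I) (hs' : s₀ ∈ I') (hd : frameData v X' T' Y' s₀ = frameData v X T Y s₀) :
    I' = I ∧ ∃ M : Matrix (Fin 3) (Fin 3) ℝ, IsConeIsometry M ∧ M *ᵥ v = v ∧
      ∀ s ∈ I, X' s = M *ᵥ X s := by
  have aux : ∀ {I I' : Set ℝ} {X T Y X' T' Y' : ℝ → Mink3}, IsMaximalFrame v c I X T Y →
      IsMaximalFrame v c I' X' T' Y' → s₀ ∈ I → s₀ ∈ I' →
      frameData v X' T' Y' s₀ = frameData v X T Y s₀ → I ⊆ I' ∧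
      ∃ M : Matrix (Fin 3) (Fin 3) ℝ, IsConeIsometry M ∧ M *ᵥ v = v ∧
      ∀ s ∈ I, X' s = M *ᵥ X s := by
    intro I I' X T Y X' T' Y' h h' hs hs' hd
    have hF := h.sol.frame s₀ hs
    have hF' := h'.sol.frame s₀ hs'
    obtain ⟨M, hM, hMu⟩ := hF.exists_isometry hF'
    simp only [frameData, Prod.mk.injEq] at hd
    have hv : M *ᵥ v = v := by
      conv_rhs => rw [hF'.expand v]
      rw [hMu, mink_comm v, mink_comm v, mink_comm v, hd.1, hd.2.1, hd.2.2]
    obtain ⟨h1, h2⟩ := h'.eqOn (h.sol.image hM hv) hs' hs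
      (by rw [hMu]; simp [hF.YX, hF.TX, hF.XX]) (by rw [hMu]; simp [hF.YT, hF.TT, hF.XT])
      (by rw [hMu]; simp [hF.YY, hF.TY, hF.XY])
    exact ⟨h1, M, hM, hv, fun s hs => (h2 hs).symm⟩
  obtain ⟨h1, h2⟩ := aux h h' hs hs' hd
  exact ⟨Subset.antisymm (aux h' h hs' hs hd.symm).1 h1, h2⟩

theorem IsOpenInterval.preimage_neg (h : IsOpenInterval I) :
    IsOpenInterval ((fun s => -s) ⁻¹' I) := by
  refine .mk' (h.1.preimage continuous_neg) ?_ ?_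
  · exact ⟨fun a ha b hb x hx => h.ordConnected.out hb ha ⟨neg_le_neg hx.2, neg_le_neg hx.1⟩⟩
  · obtain ⟨s, hs⟩ := h.2.nonempty
    exact ⟨-s, by simpa using hs⟩

/-- Reversing the parameter flips `T`, hence `v` must be flipped to keep `k = c + ⟨T, v⟩`. This
reduces left ends to right ends. -/
theorem IsFrameSolution.reverse (h : IsFrameSolution v c I X T Y) :
    IsFrameSolution (-v) c ((fun s => -s) ⁻¹' I) (fun s => X (-s)) (fun s => -T (-s))
      fun s => Y (-s) := by
  have comp : ∀ {f : ℝ → Mink3} {f' : Mink3} {s : ℝ}, HasDerivAt f f' (-s) →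
      HasDerivAt (fun s => f (-s)) (-f') s := fun hf => by
    exact (hf.scomp _ (hasDerivAt_neg _)).congr_deriv (by simp)
  refine ⟨h.interval.preimage_neg, fun s hs => (h.frame _ hs).neg, fun s hs => comp (h.dX _ hs),
    fun s hs => (comp (h.dT _ hs)).neg.congr_deriv ?_, fun s hs => (comp (h.dY _ hs)).congr_deriv ?_⟩
  · simp
  · simp

theorem IsMaximalFrame.reverse (h : IsMaximalFrame v c I X T Y) :
    IsMaximalFrame (-v) c ((fun s => -s) ⁻¹' I) (fun s => X (-s)) (fun s => -T (-s))
      fun s => Y (-s) := by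
  refine ⟨h.sol.reverse, fun I' X' T' Y' h' hI hX => ?_⟩
  have hr := h'.reverse
  rw [neg_neg] at hr
  have := h.maximal _ _ _ _ hr (fun s hs => hI (by simpa using hs))
    fun s hs => by simpa using hX (show -s ∈ _ by simpa using hs)
  rw [← this]
  ext s
  simp

/-- A maximal curve whose curvature is bounded near its right end is defined up to `+∞`. -/
theorem IsMaximalFrame.not_bddAbove (h : IsMaximalFrame v c I X T Y) {a B : ℝ} (ha : a ∈ I)
    (hB : ∀ s ∈ I, a ≤ s → |c + mink (T s) v| ≤ B) : ¬ BddAbove I := by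
  intro hb
  have hB0 : 0 ≤ B := (abs_nonneg _).trans (hB a ha le_rfl)
  obtain ⟨b, hb'⟩ := id hb
  have hsol := h.sol.isSolution
  set W : ℝ → Mink3 × Mink3 × Mink3 := fun s => (X s, T s, Y s) with hWdef
  -- With `|k| ≤ B` the frame system satisfies `‖W'‖ ≤ (1 + B)‖W‖`, so Gronwall bounds `W` up to a
  -- finite end, and the solution would extend.
  have hbound : ∀ s ∈ I, a ≤ s → ‖W s‖ ≤ ‖W a‖ * Real.exp ((1 + B) * (b - a)) := by
    intro s hs has
    have hsub : Icc a s ⊆ I := h.sol.interval.ordConnected.out ha hs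
    have h1 := norm_le_gronwallBound_of_norm_deriv_right_le (K := 1 + B) (ε := 0)
      (hsol.continuousOn.mono hsub)
      (fun x hx => (hsol.hasDerivAt x (hsub (Ico_subset_Icc_self hx))).hasDerivWithinAt)
      (le_refl ‖W a‖) (fun x hx => ?_) s ⟨has, le_rfl⟩
    · rw [gronwallBound_ε0] at h1
      refine h1.trans (mul_le_mul_of_nonneg_left (Real.exp_le_exp.2 ?_) (norm_nonneg _))
      exact mul_le_mul_of_nonneg_left (by linarith [hb' hs]) (by linarith)
    · have hk := hB x (hsub (Ico_subset_Icc_self hx)) hx.1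
      have nX : ‖X x‖ ≤ ‖W x‖ := norm_fst_le (W x)
      have nW : ‖(W x).2‖ ≤ ‖W x‖ := norm_snd_le (W x)
      have nT : ‖T x‖ ≤ ‖W x‖ := (norm_fst_le (W x).2).trans nW
      have nY : ‖Y x‖ ≤ ‖W x‖ := (norm_snd_le (W x).2).trans nW
      have h0 := norm_nonneg (W x)
      rw [add_zero]
      refine norm_prod_le_iff.2 ⟨?_, norm_prod_le_iff.2 ⟨?_, ?_⟩⟩
      · exact nT.trans (by nlinarith)
      · calc ‖(c + mink (T x) v) • X x - Y x‖ ≤ |c + mink (T x) v| * ‖X x‖ + ‖Y x‖ :=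
              (norm_sub_le _ _).trans (by rw [norm_smul, Real.norm_eq_abs])
          _ ≤ B * ‖W x‖ + ‖W x‖ := by gcongr
          _ = (1 + B) * ‖W x‖ := by ring
      · calc ‖-(c + mink (T x) v) • T x‖ = |c + mink (T x) v| * ‖T x‖ := by
              rw [norm_smul, norm_neg, Real.norm_eq_abs]
          _ ≤ B * ‖W x‖ := by gcongr
          _ ≤ (1 + B) * ‖W x‖ := by nlinarith
  obtain ⟨I', W', hW', hsub, hne, heq⟩ :=
    hsol.exists_extension contDiff_frameField hb ha hbound
  refine hne (h.maximal I' _ _ _ (hW'.isFrameSolution (hsub ha) ?_) hsub fun s hs => ?_)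
  · rw [heq ha]; exact h.sol.frame a ha
  · simp only [heq hs, hWdef]

end Curves

/-! ### One-variable calculus: zeros, monotone limits, growth criteria. -/

section RealAnalysis

variable {f f' : ℝ → ℝ} {a b δ : ℝ}

theorem le_of_hasDerivAt_le (hab : a ≤ b) (hf : ∀ x ∈ Icc a b, HasDerivAt f (f' x) x)
    (h : ∀ x ∈ Ioo a b, f' x ≤ δ) : f b ≤ f a + δ * (b - a) := by
  rcases hab.eq_or_lt with rfl | hab
  · simp
  · obtain ⟨m, hm, hm'⟩ := exists_hasDerivAt_eq_slope f f' hab (HasDerivAt.continuousOn hf)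
      fun x hx => hf x (Ioo_subset_Icc_self hx)
    have := h m hm
    rw [hm', div_le_iff₀ (by linarith)] at this
    linarith

theorem le_of_le_hasDerivAt (hab : a ≤ b) (hf : ∀ x ∈ Icc a b, HasDerivAt f (f' x) x)
    (h : ∀ x ∈ Ioo a b, δ ≤ f' x) : f a + δ * (b - a) ≤ f b := by
  have := le_of_hasDerivAt_le (f := fun x => -f x) (f' := fun x => -f' x) (δ := -δ) hab
    (fun x hx => (hf x hx).neg) fun x hx => neg_le_neg (h x hx)
  linarith

theorem lt_of_hasDerivAt_neg (hab : a < b) (hf : ∀ x ∈ Icc a b, HasDerivAt f (f' x) x)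
    (h : ∀ x ∈ Ioo a b, f' x < 0) : f b < f a := by
  obtain ⟨m, hm, hm'⟩ := exists_hasDerivAt_eq_slope f f' hab (HasDerivAt.continuousOn hf)
    fun x hx => hf x (Ioo_subset_Icc_self hx)
  have := h m hm
  rw [hm', div_lt_iff₀ (by linarith)] at this
  linarith

theorem tendsto_atTop_of_le_hasDerivAt (hδ : 0 < δ) (hf : ∀ x, a ≤ x → HasDerivAt f (f' x) x)
    (h : ∀ x, a ≤ x → δ ≤ f' x) : Tendsto f atTop atTop := by
  have h1 : Tendsto (fun x => f a + δ * (x - a)) atTop atTop :=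
    tendsto_atTop_add_const_left _ _
      ((tendsto_atTop_add_const_right _ (-a) tendsto_id).const_mul_atTop hδ)
  refine tendsto_atTop_mono' _ ?_ h1
  filter_upwards [eventually_ge_atTop a] with x hx
  exact le_of_le_hasDerivAt hx (fun y hy => hf y hy.1) fun y hy => h y hy.1.le

theorem tendsto_atBot_of_hasDerivAt_le (hδ : 0 < δ) (hf : ∀ x, a ≤ x → HasDerivAt f (f' x) x)
    (h : ∀ x, a ≤ x → f' x ≤ -δ) : Tendsto f atTop atBot := by
  have := tendsto_atTop_of_le_hasDerivAt (f := fun x => -f x) (f' := fun x => -f' x) hδ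
    (fun x hx => (hf x hx).neg) fun x hx => by linarith [h x hx]
  exact tendsto_neg_atTop_iff.1 this

theorem HasDerivAt.eventually_lt_right {x d : ℝ} (h : HasDerivAt f d x) (hd : 0 < d) :
    ∀ᶠ y in 𝓝[>] x, f x < f y := by
  have h1 := (hasDerivWithinAt_iff_tendsto_slope' (by simp)).1 (h.hasDerivWithinAt (s := Ioi x))
  filter_upwards [h1.eventually (lt_mem_nhds hd), self_mem_nhdsWithin] with y hy hxy
  rw [slope_def_field, div_pos_iff_of_pos_right (sub_pos.2 hxy)] at hy
  linarith

theorem HasDerivAt.eventually_lt_left {x d : ℝ} (h : HasDerivAt f d x) (hd : 0 < d) :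
    ∀ᶠ y in 𝓝[<] x, f y < f x := by
  have h1 := (hasDerivWithinAt_iff_tendsto_slope' (by simp)).1 (h.hasDerivWithinAt (s := Iio x))
  filter_upwards [h1.eventually (lt_mem_nhds hd), self_mem_nhdsWithin] with y hy hxy
  have hxy' : y - x < 0 := sub_neg.2 hxy
  rw [slope_def_field] at hy
  by_contra hcon
  exact absurd (div_nonpos_of_nonneg_of_nonpos (by linarith) hxy'.le) (not_le.2 hy)

theorem exists_last_zero (hab : a ≤ b) (hf : ContinuousOn f (Icc a b)) (ha : 0 ≤ f a)
    (hb : f b < 0) : ∃ m ∈ Ico a b, f m = 0 ∧ ∀ x ∈ Ioc m b, f x < 0 := by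
  have hK : IsCompact (Icc a b ∩ f ⁻¹' {0}) :=
    isCompact_Icc.of_isClosed_subset (hf.preimage_isClosed_of_isClosed isClosed_Icc isClosed_singleton)
      inter_subset_left
  have hne : (Icc a b ∩ f ⁻¹' {0}).Nonempty := by
    obtain ⟨m, hm, hm0⟩ := intermediate_value_Icc' hab hf ⟨hb.le, ha⟩
    exact ⟨m, hm, hm0⟩
  obtain ⟨m, ⟨hm, hm0⟩, hmax⟩ := hK.exists_isGreatest hne
  refine ⟨m, ⟨hm.1, lt_of_le_of_ne hm.2 ?_⟩, hm0, fun x hx => ?_⟩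
  · rintro rfl
    exact hb.ne hm0
  · by_contra hcon
    obtain ⟨r, hr, hr0⟩ := intermediate_value_Icc' hx.2
      (hf.mono (Icc_subset_Icc_left (hm.1.trans hx.1.le))) ⟨hb.le, not_lt.1 hcon⟩
    exact absurd (hmax ⟨⟨hm.1.trans (hx.1.le.trans hr.1), hr.2⟩, hr0⟩)
      (not_le.2 (hx.1.trans_le hr.1))

theorem exists_first_zero (hab : a ≤ b) (hf : ContinuousOn f (Icc a b)) (ha : f a < 0)
    (hb : 0 ≤ f b) : ∃ m ∈ Ioc a b, f m = 0 ∧ ∀ x ∈ Ico a m, f x < 0 := by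
  obtain ⟨m, hm, hm0, h⟩ := exists_last_zero (f := fun x => f (-x)) (neg_le_neg hab)
    (hf.comp continuousOn_neg fun x hx => ⟨le_neg.1 hx.2, neg_le.1 hx.1⟩) (by simpa using hb)
    (by simpa using ha)
  refine ⟨-m, ⟨lt_neg.1 hm.2, neg_le.1 hm.1⟩, hm0, fun x hx => ?_⟩
  simpa using h (-x) ⟨lt_neg.1 hx.2, neg_le_neg hx.1⟩

theorem exists_negative_gap {z : ℝ} (hf : ContinuousOn f (Icc a b)) (haz : a < z) (hzb : z < b)
    (ha : f a = 0) (hb : f b = 0) (hz : f z < 0) :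
    ∃ x y, a ≤ x ∧ x < y ∧ y ≤ b ∧ f x = 0 ∧ f y = 0 ∧ ∀ r ∈ Ioo x y, f r < 0 := by
  obtain ⟨x, hx, hx0, hx'⟩ :=
    exists_last_zero haz.le (hf.mono (Icc_subset_Icc_right hzb.le)) ha.ge hz
  obtain ⟨y, hy, hy0, hy'⟩ :=
    exists_first_zero hzb.le (hf.mono (Icc_subset_Icc_left haz.le)) hz hb.ge
  refine ⟨x, y, hx.1, hx.2.trans hy.1, hy.2, hx0, hy0, fun r hr => ?_⟩
  rcases le_total r z with h | h
  · exact hx' r ⟨hr.1, h⟩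
  · exact hy' r ⟨h, hr.2⟩

/-- Between three zeros of a function with a simple zero in the middle, the function is negative on
some interval between two zeros. -/
theorem exists_negative_gap_of_three_zeros {m d : ℝ} (hf : ContinuousOn f (Icc a b)) (ham : a < m)
    (hmb : m < b) (ha : f a = 0) (hm : f m = 0) (hb : f b = 0) (hd : HasDerivAt f d m)
    (hd0 : d ≠ 0) :
    ∃ x y, a ≤ x ∧ x < y ∧ y ≤ b ∧ f x = 0 ∧ f y = 0 ∧ ∀ r ∈ Ioo x y, f r < 0 := by
  rcases lt_or_gt_of_ne hd0 with h | h
  · obtain ⟨z, hz, hzm⟩ := ((HasDerivAt.eventually_lt_right hd.neg (neg_pos.2 h)).and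
      (Ioo_mem_nhdsGT hmb)).exists
    simp only [hm, Pi.neg_apply] at hz
    obtain ⟨x, y, h1, h2⟩ := exists_negative_gap (hf.mono (Icc_subset_Icc_left ham.le)) hzm.1 hzm.2
      hm hb (by linarith)
    exact ⟨x, y, ham.le.trans h1, h2⟩
  · obtain ⟨z, hz, hzm⟩ := ((HasDerivAt.eventually_lt_left hd h).and (Ioo_mem_nhdsLT ham)).exists
    rw [hm] at hz
    obtain ⟨x, y, h1, h2, h3, h4⟩ := exists_negative_gap (hf.mono (Icc_subset_Icc_right hmb.le))
      hzm.1 hzm.2 ha hm hz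
    exact ⟨x, y, h1, h2, h3.trans hmb.le, h4⟩

theorem encard_zeros_le_two {I : Set ℝ} (hI : I.OrdConnected)
    (hf : ∀ x ∈ I, HasDerivAt f (f' x) x) (hsimple : ∀ x ∈ I, f x = 0 → f' x ≠ 0)
    (hgap : ∀ x ∈ I, ∀ y ∈ I, x < y → f x = 0 → f y = 0 → ¬ ∀ r ∈ Ioo x y, f r < 0) :
    {s | s ∈ I ∧ f s = 0}.encard ≤ 2 := by
  have key : ∀ x y z, x < y → y < z → x ∈ I → y ∈ I → z ∈ I → f x = 0 → f y = 0 → f z = 0 →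
      False := by
    intro x y z hxy hyz hx hy hz hx0 hy0 hz0
    have hsub : Icc x z ⊆ I := hI.out hx hz
    obtain ⟨p, r, h1, h2, h3, h4, h5, h6⟩ := exists_negative_gap_of_three_zeros
      (HasDerivAt.continuousOn fun s hs => hf s (hsub hs)) hxy hyz hx0 hy0 hz0 (hf y hy)
      (hsimple y hy hy0)
    exact hgap p (hsub ⟨h1, h2.le.trans h3⟩) r (hsub ⟨h1.trans h2.le, h3⟩) h2 h4 h5 h6
  by_contra hcon
  have h3 : (3 : ℕ∞) ≤ {s | s ∈ I ∧ f s = 0}.encard := by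
    have := Order.add_one_le_of_lt (not_le.1 hcon)
    exact this
  obtain ⟨S, hS, hcard⟩ := exists_subset_encard_eq h3
  obtain ⟨x, y, z, hxy, hxz, hyz, rfl⟩ := encard_eq_three.1 hcard
  obtain ⟨hx, hx0⟩ := hS (show x ∈ _ by simp)
  obtain ⟨hy, hy0⟩ := hS (show y ∈ _ by simp)
  obtain ⟨hz, hz0⟩ := hS (show z ∈ _ by simp)
  rcases lt_or_gt_of_ne hxy with h1 | h1 <;> rcases lt_or_gt_of_ne hyz with h2 | h2 <;>
    rcases lt_or_gt_of_ne hxz with h3 | h3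
  all_goals first
    | exact key x y z (by assumption) (by assumption) hx hy hz hx0 hy0 hz0
    | exact key x z y (by assumption) (by assumption) hx hz hy hx0 hz0 hy0
    | exact key y x z (by assumption) (by assumption) hy hx hz hy0 hx0 hz0
    | exact key y z x (by assumption) (by assumption) hy hz hx hy0 hz0 hx0
    | exact key z x y (by assumption) (by assumption) hz hx hy hz0 hx0 hy0
    | exact key z y x (by assumption) (by assumption) hz hy hx hz0 hy0 hx0

theorem exists_tendsto_of_monotone {B : ℝ} (hf : MonotoneOn f (Ici a)) (hB : ∀ x, a ≤ x → f x ≤ B) :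
    ∃ L, Tendsto f atTop (𝓝 L) := by
  have hm : Monotone fun x => f (max a x) := fun x y hxy =>
    hf (mem_Ici.2 (le_max_left _ _)) (mem_Ici.2 (le_max_left _ _)) (max_le_max le_rfl hxy)
  have hbdd : BddAbove (range fun x => f (max a x)) :=
    ⟨B, by rintro _ ⟨x, rfl⟩; exact hB _ (le_max_left _ _)⟩
  refine ⟨_, (tendsto_atTop_ciSup hm hbdd).congr' ?_⟩
  filter_upwards [eventually_ge_atTop a] with x hx
  rw [max_eq_right hx]

theorem exists_tendsto_of_antitone {B : ℝ} (hf : AntitoneOn f (Ici a)) (hB : ∀ x, a ≤ x → B ≤ f x) :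
    ∃ L, Tendsto f atTop (𝓝 L) := by
  obtain ⟨L, hL⟩ := exists_tendsto_of_monotone (f := fun x => -f x) (B := -B) hf.neg
    fun x hx => neg_le_neg (hB x hx)
  exact ⟨-L, by simpa using hL.neg⟩

/-- A function that decreases at a definite rate wherever it is at least `ε` is eventually at most
`ε`. -/
theorem eventually_le_of_hasDerivAt_le {ε : ℝ} (hδ : 0 < δ)
    (hf : ∀ x, a ≤ x → HasDerivAt f (f' x) x) (h : ∀ x, a ≤ x → ε ≤ f x → f' x ≤ -δ) :
    ∀ᶠ x in atTop, f x ≤ ε := by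
  obtain ⟨b, hab, hb⟩ : ∃ b, a ≤ b ∧ f b ≤ ε := by
    by_contra! hcon
    have h1 := tendsto_atBot_of_hasDerivAt_le hδ hf fun x hx => h x hx (hcon x hx).le
    obtain ⟨x, hx, hax⟩ := ((h1.eventually_le_atBot ε).and (eventually_ge_atTop a)).exists
    exact absurd hx (not_le.2 (hcon x hax))
  filter_upwards [eventually_ge_atTop b] with x hx
  by_contra hcon
  obtain ⟨m, hm, hm0, hm'⟩ := exists_last_zero (f := fun x => ε - f x) hx
    (continuousOn_const.sub (HasDerivAt.continuousOn fun y hy => hf y (hab.trans hy.1)))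
    (by linarith) (by linarith)
  have h1 := le_of_hasDerivAt_le (δ := -δ) hm.2.le (fun y hy => hf y (hab.trans (hm.1.trans hy.1)))
    fun y hy => h y (hab.trans (hm.1.trans hy.1.le)) (by linarith [hm' y ⟨hy.1, hy.2.le⟩])
  nlinarith [hm.2]

/-- A bounded function that increases at a definite rate wherever it is at least `ε` stays below
`ε`. -/
theorem lt_of_le_hasDerivAt_of_bounded {ε B : ℝ} (hδ : 0 < δ)
    (hf : ∀ x, a ≤ x → HasDerivAt f (f' x) x) (h : ∀ x, a ≤ x → ε ≤ f x → δ ≤ f' x)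
    (hB : ∀ x, a ≤ x → f x ≤ B) : ∀ x, a ≤ x → f x < ε := by
  intro x hx
  by_contra hcon
  -- To drop below `ε` the function must leave the level `ε` downwards, but its derivative is
  -- positive there.
  have hstay : ∀ y, x ≤ y → ε ≤ f y := by
    intro y hy
    by_contra hy'
    obtain ⟨m, hm, hm0, hm'⟩ := exists_last_zero (f := fun x => f x - ε) hy
      ((HasDerivAt.continuousOn fun z hz => hf z (hx.trans hz.1)).sub continuousOn_const)
      (by linarith) (by linarith)
    have hd := h m (hx.trans hm.1) (by linarith)
    obtain ⟨z, hz, hzy⟩ := ((HasDerivAt.eventually_lt_right (hf m (hx.trans hm.1))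
      (hδ.trans_le hd)).and (Ioo_mem_nhdsGT hm.2)).exists
    linarith [hm' z ⟨hzy.1, hzy.2.le⟩]
  have h1 := tendsto_atTop_of_le_hasDerivAt hδ (fun y hy => hf y (hx.trans hy))
    fun y hy => h y (hx.trans hy) (hstay y hy)
  obtain ⟨y, hy, hay⟩ := ((h1.eventually_gt_atTop B).and (eventually_ge_atTop a)).exists
  linarith [hB y hay]

/-- Lemma of Barbalat: a function with bounded derivative and integrable square tends to `0`. -/
theorem tendsto_zero_of_sq_integrable {H : ℝ → ℝ} {L B : ℝ}
    (hH : ∀ x, a ≤ x → HasDerivAt H (-f x ^ 2) x) (hB : ∀ x, a ≤ x → B ≤ H x)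
    (hf : ∀ x, a ≤ x → HasDerivAt f (f' x) x) (hL : ∀ x, a ≤ x → |f' x| ≤ L) :
    Tendsto f atTop (𝓝 0) := by
  have hanti : AntitoneOn H (Ici a) := fun x hx y hy hxy => by
    have := le_of_hasDerivAt_le (δ := 0) hxy (fun z hz => hH z (le_trans hx hz.1))
      fun z hz => by nlinarith [sq_nonneg (f z)]
    linarith
  obtain ⟨l, hl⟩ := exists_tendsto_of_antitone hanti hB
  have hL0 : 0 ≤ L := (abs_nonneg _).trans (hL a le_rfl)
  rw [Metric.tendsto_nhds]
  intro ε hε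
  -- A length on which `f` changes by at most `ε / 2`; the `+ 1` covers `L = 0`. If `|f x| ≥ ε`,
  -- then `H` would drop by at least `d (ε / 2)²` over `[x, x + d]`, impossible for large `x` since
  -- `H` converges.
  set d := ε / (2 * (L + 1)) with hd
  have hdpos : 0 < d := by positivity
  have hLd : L * d ≤ ε / 2 := by
    rw [hd, mul_div_assoc', div_le_div_iff₀ (by positivity) (by positivity)]
    nlinarith
  have hdiff : Tendsto (fun x => H x - H (x + d)) atTop (𝓝 (l - l)) :=
    hl.sub (hl.comp (tendsto_atTop_add_const_right _ d tendsto_id))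
  rw [sub_self] at hdiff
  filter_upwards [hdiff.eventually (gt_mem_nhds (show (0 : ℝ) < d * (ε / 2) ^ 2 by positivity)),
    eventually_ge_atTop a] with x hx hax
  rw [Real.dist_eq, sub_zero]
  by_contra hcon
  have hlow : ∀ y ∈ Icc x (x + d), ε / 2 ≤ |f y| := by
    intro y hy
    have h1 := le_of_hasDerivAt_le (δ := L) hy.1 (fun z hz => hf z (hax.trans hz.1))
      fun z hz => (abs_le.1 (hL z (hax.trans hz.1.le))).2
    have h2 := le_of_le_hasDerivAt (δ := -L) hy.1 (fun z hz => hf z (hax.trans hz.1))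
      fun z hz => (abs_le.1 (hL z (hax.trans hz.1.le))).1
    have h3 : L * (y - x) ≤ L * d := mul_le_mul_of_nonneg_left (by linarith [hy.2]) hL0
    have h4 := abs_sub_abs_le_abs_sub (f x) (f y)
    have h5 : |f x - f y| ≤ ε / 2 := abs_le.2 ⟨by linarith, by linarith⟩
    linarith
  have := le_of_hasDerivAt_le (δ := -(ε / 2) ^ 2) (show x ≤ x + d by linarith)
    (fun z hz => hH z (hax.trans hz.1)) fun z hz => by
      have := hlow z (Ioo_subset_Icc_self hz)
      rw [← sq_abs (f z)]
      have : (ε / 2) ^ 2 ≤ |f z| ^ 2 := pow_le_pow_left₀ (by positivity) this 2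
      linarith
  linarith

/-- The complement of at most two points in an interval has at most three components. -/
theorem card_components_le_three {I : Set ℝ} (hI : I.OrdConnected) {k : ℝ → ℝ}
    (hz : {s | s ∈ I ∧ k s = 0}.encard ≤ 2) :
    ENat.card (ConnectedComponents (regularSet I k)) ≤ 3 := by
  classical
  set Z := {s | s ∈ I ∧ k s = 0} with hZ
  -- A component is labelled by the number of zeros to its left. This number is at most `2`, so the
  -- reduction modulo `3` loses nothing.
  let cnt : regularSet I k → Fin 3 := fun s => Fin.ofNat 3 (Z ∩ Iio (s : ℝ)).ncard
  have hfin : Z.Finite := finite_of_encard_le_coe hz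
  have hle : ∀ s : ℝ, (Z ∩ Iio s).ncard < 3 := by
    intro s
    have h1 : (Z ∩ Iio s).ncard ≤ Z.ncard := ncard_le_ncard inter_subset_left hfin
    have h2 : (Z.ncard : ℕ∞) ≤ 2 := by rwa [hfin.cast_ncard_eq]
    have h3 : Z.ncard ≤ 2 := by exact_mod_cast h2
    omega
  have key : ∀ s t : regularSet I k, (s : ℝ) ≤ t → cnt s = cnt t →
      (s : ConnectedComponents (regularSet I k)) = t := by
    intro s t hst hc
    have hc' : (Z ∩ Iio (s : ℝ)).ncard = (Z ∩ Iio (t : ℝ)).ncard := by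
      have := congrArg Fin.val hc
      simpa [cnt, Fin.ofNat, Nat.mod_eq_of_lt (hle _)] using this
    have heq : Z ∩ Iio (s : ℝ) = Z ∩ Iio (t : ℝ) :=
      eq_of_subset_of_ncard_le (inter_subset_inter_right _ (Iio_subset_Iio hst)) hc'.ge
        (hfin.subset inter_subset_left)
    have hsub : Icc (s : ℝ) t ⊆ regularSet I k := by
      intro x hx
      have hxI : x ∈ I := hI.out s.2.1 t.2.1 hx
      refine ⟨hxI, fun hx0 => ?_⟩
      rcases hx.2.eq_or_lt with rfl | hlt
      · exact t.2.2 hx0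
      · have : x ∈ Z ∩ Iio (s : ℝ) := heq ▸ ⟨⟨hxI, hx0⟩, hlt⟩
        exact absurd hx.1 (not_le.2 this.2)
    rw [ConnectedComponents.coe_eq_coe']
    have hpre : IsPreconnected ((↑) ⁻¹' Icc (s : ℝ) t : Set (regularSet I k)) := by
      rw [← Topology.IsInducing.subtypeVal.isPreconnected_image,
        Subtype.image_preimage_coe, inter_eq_self_of_subset_right hsub]
      exact isPreconnected_Icc
    exact hpre.subset_connectedComponent (x := t) ⟨hst, le_rfl⟩ ⟨le_rfl, hst⟩
  obtain ⟨out, hout⟩ := (ConnectedComponents.surjective_coe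
    (α := regularSet I k)).hasRightInverse
  have hinj : Function.Injective fun C => cnt (out C) := by
    intro C D h
    rw [← hout C, ← hout D]
    rcases le_total (out C : ℝ) (out D : ℝ) with hl | hl
    · exact key _ _ hl h
    · exact (key _ _ hl h.symm).symm
  have := ENat.card_le_card_of_injective hinj
  simpa using this

end RealAnalysis

/-! ### Dynamics of the triple `(a, t, n)`, that is `(α, τ, η)`: zeros and ends. -/

section Data

variable {q c : ℝ} {I : Set ℝ} {a t n : ℝ → ℝ}

/-- The equations for the triple `(a, t, n) = (⟨X, v⟩, ⟨T, v⟩, ⟨Y, v⟩)` of a curve with curvature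
`c + t`. -/
structure IsDataSolution (q c : ℝ) (I : Set ℝ) (a t n : ℝ → ℝ) : Prop where
  interval : IsOpenInterval I
  da : ∀ s ∈ I, HasDerivAt a (t s) s
  dt : ∀ s ∈ I, HasDerivAt t ((c + t s) * a s - n s) s
  dn : ∀ s ∈ I, HasDerivAt n (-((c + t s) * t s)) s
  quadric : ∀ s ∈ I, 2 * a s * n s + t s ^ 2 = q

/-- A triple that does not belong to a conic section. -/
def IsRegularData (c a t n : ℝ) : Prop := ¬ (t = 0 ∧ n = c * a) ∧ ¬ (t = -c ∧ n = 0)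

theorem IsDataSolution.dk (h : IsDataSolution q c I a t n) {s : ℝ} (hs : s ∈ I) :
    HasDerivAt (fun s => c + t s) ((c + t s) * a s - n s) s := (h.dt s hs).const_add c

/-- The Lyapunov function of the system, used both for the zeros and for the ends. -/
theorem IsDataSolution.dh (h : IsDataSolution q c I a t n) {s : ℝ} (hs : s ∈ I) :
    HasDerivAt (fun s => n s + c * a s) (-t s ^ 2) s :=
  ((h.dn s hs).add ((h.da s hs).const_mul c)).congr_deriv (by ring)

/-- The equations for the triple as an autonomous vector field. -/
def dataField (c : ℝ) (p : ℝ × ℝ × ℝ) : ℝ × ℝ × ℝ :=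
  (p.2.1, (c + p.2.1) * p.1 - p.2.2, -((c + p.2.1) * p.2.1))

theorem contDiff_dataField {m : WithTop ℕ∞} : ContDiff ℝ m (dataField c) := by
  unfold dataField
  fun_prop

theorem IsDataSolution.isSolution (h : IsDataSolution q c I a t n) :
    IsSolution (dataField c) I fun s => (a s, t s, n s) :=
  ⟨h.interval, fun s hs => (h.da s hs).prodMk ((h.dt s hs).prodMk (h.dn s hs))⟩

/-- If the triple belongs to a conic section at one parameter, then the curvature is constant. -/
theorem IsDataSolution.const_of_not_regular (h : IsDataSolution q c I a t n) {s₀ : ℝ} (hs₀ : s₀ ∈ I)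
    (h₀ : ¬ IsRegularData c (a s₀) (t s₀) (n s₀)) : ∃ e, ∀ s ∈ I, t s = e := by
  rw [IsRegularData, not_and_or, not_not, not_not] at h₀
  rcases h₀ with ⟨h1, h2⟩ | ⟨h1, h2⟩
  · have h' : IsSolution (dataField c) I fun _ => (a s₀, t s₀, n s₀) :=
      ⟨h.interval, fun s _ => (hasDerivAt_const s _).congr_deriv (by simp [dataField, h1, h2, Prod.ext_iff])⟩
    exact ⟨t s₀, fun s hs => congrArg (fun p => p.2.1)
      (h.isSolution.eqOn contDiff_dataField h' hs₀ rfl hs)⟩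
  · have h' : IsSolution (dataField c) I fun s => (a s₀ + -c * (s - s₀), -c, 0) := by
      refine ⟨h.interval, fun s _ => ?_⟩
      have hl : HasDerivAt (fun s => a s₀ + -c * (s - s₀)) (-c) s := by
        simpa using (((hasDerivAt_id s).sub_const s₀).const_mul (-c)).const_add (a s₀)
      exact (hl.prodMk ((hasDerivAt_const s (-c)).prodMk (hasDerivAt_const s 0))).congr_deriv
        (by simp [dataField])
    exact ⟨-c, fun s hs => congrArg (fun p => p.2.1)
      (h.isSolution.eqOn contDiff_dataField h' hs₀ (by simp [h1, h2]) hs)⟩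

/-- If the curvature is constant, then the triples belong to a conic section. -/
theorem IsDataSolution.not_regular_of_const (h : IsDataSolution q c I a t n) {e : ℝ}
    (he : ∀ s ∈ I, t s = e) {s : ℝ} (hs : s ∈ I) : ¬ IsRegularData c (a s) (t s) (n s) := by
  have hnhds : ∀ r ∈ I, I ∈ 𝓝 r := fun r hr => h.interval.1.mem_nhds hr
  have h1 : ∀ r ∈ I, (c + e) * a r - n r = 0 := fun r hr => by
    have := (h.dt r hr).unique ((hasDerivAt_const r e).congr_of_eventuallyEq
      (eventually_of_mem (hnhds r hr) he))
    rwa [he r hr] at this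
  have h2 := (((h.da s hs).const_mul (c + e)).sub (h.dn s hs)).unique
    ((hasDerivAt_const s (0 : ℝ)).congr_of_eventuallyEq (eventually_of_mem (hnhds s hs) h1))
  rw [he s hs] at h2
  have h3 := h1 s hs
  rw [IsRegularData, not_and_or, not_not, not_not, he s hs]
  rcases mul_eq_zero.1 (show (c + e) * e = 0 by linarith) with h4 | h4
  · right
    refine ⟨by linarith, ?_⟩
    rw [h4] at h3
    linarith
  · left
    refine ⟨h4, ?_⟩
    rw [h4] at h3
    linarith

/-- At a zero of `k` the derivative is `k' = -n`, and `n ≠ 0` off the conic sections. The sign of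
`k` inside the gap therefore fixes the sign of `n` at both ends. -/
theorem IsDataSolution.gap_signs (h : IsDataSolution q c I a t n)
    (hreg : ∀ s ∈ I, IsRegularData c (a s) (t s) (n s)) {x y : ℝ} (hx : x ∈ I) (hy : y ∈ I)
    (hxy : x < y) (hx0 : c + t x = 0) (hy0 : c + t y = 0) :
    ((∀ r ∈ Ioo x y, c + t r < 0) → 0 < n x ∧ n y < 0) ∧
    ((∀ r ∈ Ioo x y, 0 < c + t r) → n x < 0 ∧ 0 < n y) := by
  have hn : ∀ s ∈ I, c + t s = 0 → n s ≠ 0 := fun s hs h0 hn =>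
    (hreg s hs).2 ⟨by linarith, hn⟩
  have hdx := h.dk hx
  have hdy := h.dk hy
  rw [hx0, zero_mul, zero_sub] at hdx
  rw [hy0, zero_mul, zero_sub] at hdy
  constructor
  · intro hneg
    refine ⟨lt_of_le_of_ne ?_ (hn x hx hx0).symm, lt_of_le_of_ne ?_ (hn y hy hy0)⟩
    · by_contra hcon
      obtain ⟨z, hz, hz'⟩ := ((HasDerivAt.eventually_lt_right hdx (by linarith)).and
        (Ioo_mem_nhdsGT hxy)).exists
      linarith [hneg z hz']
    · by_contra hcon
      obtain ⟨z, hz, hz'⟩ := ((HasDerivAt.eventually_lt_left hdy.neg (by linarith)).and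
        (Ioo_mem_nhdsLT hxy)).exists
      simp only [Pi.neg_apply] at hz
      linarith [hneg z hz']
  · intro hpos
    refine ⟨lt_of_le_of_ne ?_ (hn x hx hx0), lt_of_le_of_ne ?_ (hn y hy hy0).symm⟩
    · by_contra hcon
      obtain ⟨z, hz, hz'⟩ := ((HasDerivAt.eventually_lt_right hdx.neg (by linarith)).and
        (Ioo_mem_nhdsGT hxy)).exists
      simp only [Pi.neg_apply] at hz
      linarith [hpos z hz']
    · by_contra hcon
      obtain ⟨z, hz, hz'⟩ := ((HasDerivAt.eventually_lt_left hdy (by linarith)).and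
        (Ioo_mem_nhdsLT hxy)).exists
      linarith [hpos z hz']

/-- The curvature has at most two zeros. -/
theorem IsDataSolution.encard_zeros_le_two (h : IsDataSolution q c I a t n)
    (hreg : ∀ s ∈ I, IsRegularData c (a s) (t s) (n s)) :
    {s | s ∈ I ∧ c + t s = 0}.encard ≤ 2 := by
  have hout := h.interval.ordConnected
  have hsimple : ∀ s ∈ I, c + t s = 0 → (c + t s) * a s - n s ≠ 0 := fun s hs h0 hd => by
    rw [h0, zero_mul, zero_sub, neg_eq_zero] at hd
    exact (hreg s hs).2 ⟨by linarith, hd⟩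
  have hquad : ∀ s ∈ I, c + t s = 0 → 2 * a s * n s = q - c ^ 2 := fun s hs h0 => by
    have := h.quadric s hs
    rw [show t s = -c by linarith] at this
    linarith
  have neg_case : (∀ x ∈ I, ∀ y ∈ I, x < y → c + t x = 0 → c + t y = 0 →
      ¬ ∀ r ∈ Ioo x y, 0 < c + t r) → {s | s ∈ I ∧ c + t s = 0}.encard ≤ 2 := by
    intro hgap
    have := LightCone.encard_zeros_le_two (f := fun s => -(c + t s)) hout
      (fun s hs => (h.dk hs).neg) (fun s hs h0 => neg_ne_zero.2 (hsimple s hs (neg_eq_zero.1 h0)))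
      fun x hx y hy hxy hx0 hy0 hr => hgap x hx y hy hxy (neg_eq_zero.1 hx0) (neg_eq_zero.1 hy0)
        fun r hr' => neg_lt_zero.1 (hr r hr')
    simpa only [neg_eq_zero] using this
  rcases le_or_gt c 0 with hc | hc
  -- For `c ≤ 0` and `k > 0` one has `t = k - c > 0`, so `n' = -kt < 0`, while a positive gap needs
  -- `n` to go from negative to positive.
  · refine neg_case fun x hx y hy hxy hx0 hy0 hpos => ?_
    obtain ⟨h1, h2⟩ := (h.gap_signs hreg hx hy hxy hx0 hy0).2 hpos
    have := le_of_hasDerivAt_le (δ := 0) hxy.le (fun s hs => h.dn s (hout.out hx hy hs))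
      fun s hs => by nlinarith [hpos s hs, mul_pos (hpos s hs) (hpos s hs)]
    linarith
  · rcases le_or_gt q (c ^ 2) with hq | hq
    -- On a negative gap `t = k - c < 0`, so `a` decreases strictly. But `2an = q - c² ≤ 0` at the
    -- ends, where `n` passes from positive to negative, forces `a x ≤ 0 ≤ a y`.
    · refine LightCone.encard_zeros_le_two (f := fun s => c + t s) hout (fun s hs => h.dk hs) hsimple
        fun x hx y hy hxy hx0 hy0 hneg => ?_
      obtain ⟨h1, h2⟩ := (h.gap_signs hreg hx hy hxy hx0 hy0).1 hneg
      have hlt := lt_of_hasDerivAt_neg hxy (fun s hs => h.da s (hout.out hx hy hs))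
        fun s hs => by linarith [hneg s hs]
      have h3 := hquad x hx hx0
      have h4 := hquad y hy hy0
      have h5 : a x ≤ 0 := by
        by_contra hcon
        nlinarith [mul_pos (not_le.1 hcon) h1]
      have h6 : 0 ≤ a y := by
        by_contra hcon
        nlinarith [mul_pos_of_neg_of_neg (not_le.1 hcon) h2]
      linarith
    -- Now `2an = q - c² > 0` at the ends, so `a` has the sign of `n` there, and on a positive gap
    -- `n + ca` would pass from negative to positive although it is nonincreasing.
    · refine neg_case fun x hx y hy hxy hx0 hy0 hpos => ?_
      obtain ⟨h1, h2⟩ := (h.gap_signs hreg hx hy hxy hx0 hy0).2 hpos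
      have hle := le_of_hasDerivAt_le (δ := 0) hxy.le (fun s hs => h.dh (hout.out hx hy hs))
        fun s hs => by nlinarith [sq_nonneg (t s)]
      have h3 := hquad x hx hx0
      have h4 := hquad y hy hy0
      have h5 : a x < 0 := by
        by_contra hcon
        nlinarith [mul_nonneg (not_lt.1 hcon) (neg_nonneg.2 h1.le)]
      have h6 : 0 < a y := by
        by_contra hcon
        nlinarith [mul_nonneg (neg_nonneg.2 (not_lt.1 hcon)) h2.le]
      nlinarith [mul_pos hc h6, mul_pos hc (neg_pos.2 h5)]

variable {s₀ B : ℝ}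

/-- Let `g = t'`. At a zero of `g` one has `g' = 2t²`, positive because `t = g = 0` is a conic
section; so `g` stays positive once it is positive, and `t` has a limit `L`. If `L ≠ 0`, then `n' →
-L²` and `a' → L` make `an` unbounded, against the quadric. -/
theorem IsDataSolution.tendsto_of_zero (h : IsDataSolution q 0 I a t n)
    (hreg : ∀ s ∈ I, IsRegularData 0 (a s) (t s) (n s)) (hI : Ici s₀ ⊆ I)
    (hB : ∀ s, s₀ ≤ s → |t s| ≤ B) : Tendsto t atTop (𝓝 0) := by
  set g : ℝ → ℝ := fun s => t s * a s - n s with hg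
  have dt : ∀ s, s₀ ≤ s → HasDerivAt t (g s) s := fun s hs =>
    (h.dt s (hI hs)).congr_deriv (by simp [hg])
  have dn : ∀ s, s₀ ≤ s → HasDerivAt n (-(t s * t s)) s := fun s hs =>
    (h.dn s (hI hs)).congr_deriv (by simp)
  have da : ∀ s, s₀ ≤ s → HasDerivAt a (t s) s := fun s hs => h.da s (hI hs)
  have dg : ∀ s, s₀ ≤ s → HasDerivAt g (g s * a s + 2 * t s ^ 2) s := fun s hs =>
    (((dt s hs).mul (da s hs)).sub (dn s hs)).congr_deriv (by ring)
  have hpos : ∀ s, s₀ ≤ s → 0 < g s → ∀ r, s ≤ r → 0 < g r := by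
    intro s hs hgs r hr
    by_contra hcon
    obtain ⟨m, hm, hm0, hm'⟩ := exists_first_zero (f := fun x => -g x) hr
      (HasDerivAt.continuousOn fun x hx => (dg x (hs.trans hx.1)).neg) (by linarith) (by linarith)
    have hsm : s₀ ≤ m := hs.trans hm.1.le
    have hgm : g m = 0 := neg_eq_zero.1 hm0
    have ht : t m ≠ 0 := fun ht => (hreg m (hI hsm)).1
      ⟨ht, by simp only [hg, ht] at hgm; linarith⟩
    have hd := dg m hsm
    rw [hgm, zero_mul, zero_add] at hd
    obtain ⟨z, hz, hz'⟩ := ((HasDerivAt.eventually_lt_left hd (by positivity)).and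
      (Ioo_mem_nhdsLT hm.1)).exists
    linarith [hm' z ⟨hz'.1.le, hz'.2⟩]
  obtain ⟨L, hL⟩ : ∃ L, Tendsto t atTop (𝓝 L) := by
    by_cases hex : ∃ s, s₀ ≤ s ∧ 0 < g s
    · obtain ⟨s, hs, hgs⟩ := hex
      refine exists_tendsto_of_monotone (a := s) (fun x hx y hy hxy => ?_)
        fun x hx => (abs_le.1 (hB x (hs.trans hx))).2
      have := le_of_le_hasDerivAt (δ := 0) hxy
        (fun r hr => dt r (hs.trans (le_trans hx hr.1)))
        fun r hr => (hpos s hs hgs r (le_trans hx hr.1.le)).le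
      linarith
    · push Not at hex
      refine exists_tendsto_of_antitone (a := s₀) (fun x hx y hy hxy => ?_)
        fun x hx => (abs_le.1 (hB x hx)).1
      have := le_of_hasDerivAt_le (δ := 0) hxy (fun r hr => dt r (le_trans hx hr.1))
        fun r hr => hex r (le_trans hx hr.1.le)
      linarith
  by_contra hne
  have hL0 : L ≠ 0 := fun e => hne (e ▸ hL)
  have hsq : Tendsto (fun s => t s * t s) atTop (𝓝 (L * L)) := hL.mul hL
  have hLL : 0 < L * L := mul_self_pos.2 hL0
  have hnbot : Tendsto n atTop atBot := by
    obtain ⟨s₁, hs₁⟩ := eventually_atTop.1 ((hsq.eventually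
      (lt_mem_nhds (show L * L / 2 < L * L by linarith))).and (eventually_ge_atTop s₀))
    exact tendsto_atBot_of_hasDerivAt_le (half_pos hLL) (fun s hs => dn s (hs₁ s hs).2)
      fun s hs => by linarith [(hs₁ s hs).1]
  have hsq' : Tendsto (fun s => q - t s ^ 2) atTop (𝓝 (q - L ^ 2)) := (hL.pow 2).const_sub q
  have hquad : ∀ᶠ s in atTop, a s * n s * 2 = q - t s ^ 2 := by
    filter_upwards [eventually_ge_atTop s₀] with s hs
    linarith [h.quadric s (hI hs)]
  rcases lt_or_gt_of_ne hL0 with hneg | hneg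
  · have habot : Tendsto a atTop atBot := by
      obtain ⟨s₁, hs₁⟩ := eventually_atTop.1 ((hL.eventually
        (gt_mem_nhds (show L < L / 2 by linarith))).and (eventually_ge_atTop s₀))
      exact tendsto_atBot_of_hasDerivAt_le (δ := -(L / 2)) (by linarith)
        (fun s hs => da s (hs₁ s hs).2) fun s hs => by linarith [(hs₁ s hs).1]
    have := (habot.atBot_mul_atBot₀ hnbot).atTop_mul_const two_pos
    exact not_tendsto_nhds_of_tendsto_atTop this _ (hsq'.congr' (hquad.mono fun _ hs => hs.symm))
  · have hatop : Tendsto a atTop atTop := by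
      obtain ⟨s₁, hs₁⟩ := eventually_atTop.1 ((hL.eventually
        (lt_mem_nhds (show L / 2 < L by linarith))).and (eventually_ge_atTop s₀))
      exact tendsto_atTop_of_le_hasDerivAt (half_pos hneg)
        (fun s hs => da s (hs₁ s hs).2) fun s hs => (hs₁ s hs).1.le
    have := (hatop.atTop_mul_atBot₀ hnbot).atBot_mul_const two_pos
    exact not_tendsto_nhds_of_tendsto_atBot this _ (hsq'.congr' (hquad.mono fun _ hs => hs.symm))

/-- Here `h = n + ca` is bounded, and `2ca² = 2ah + t² - q` then bounds `a`, since `c ≠ 0`. So `n`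
and `t'` are bounded, and `h' = -t²` puts Barbalat's lemma in force. -/
theorem IsDataSolution.tendsto_of_bddBelow (h : IsDataSolution q c I a t n) (hc : c ≠ 0)
    (hI : Ici s₀ ⊆ I) (hB : ∀ s, s₀ ≤ s → |t s| ≤ B) {m : ℝ}
    (hm : ∀ s, s₀ ≤ s → m ≤ n s + c * a s) : Tendsto t atTop (𝓝 0) := by
  have hB0 : 0 ≤ B := (abs_nonneg _).trans (hB s₀ le_rfl)
  have hM : ∀ s, s₀ ≤ s → n s + c * a s ≤ n s₀ + c * a s₀ := fun s hs => by
    have := le_of_hasDerivAt_le (δ := 0) hs (fun r hr => h.dh (hI hr.1))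
      fun r hr => by nlinarith [sq_nonneg (t r)]
    linarith
  set H := |m| + |n s₀ + c * a s₀| with hH
  have hH0 : 0 ≤ H := by positivity
  have habs : ∀ s, s₀ ≤ s → |n s + c * a s| ≤ H := fun s hs => abs_le.2
    ⟨by linarith [hm s hs, neg_abs_le m, abs_nonneg (n s₀ + c * a s₀)],
      by linarith [hM s hs, le_abs_self (n s₀ + c * a s₀), abs_nonneg m]⟩
  set A := 1 + (2 * H + B ^ 2 + |q|) / (2 * |c|) with hA
  have hcpos : 0 < |c| := abs_pos.2 hc
  have hA0 : 0 ≤ (2 * H + B ^ 2 + |q|) / (2 * |c|) := by positivity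
  have ha : ∀ s, s₀ ≤ s → |a s| ≤ A := by
    intro s hs
    by_contra hcon
    have h1 : 1 ≤ |a s| := by linarith
    have h2 : 2 * c * a s ^ 2 = 2 * a s * (n s + c * a s) + t s ^ 2 - q := by
      linarith [h.quadric s (hI hs)]
    have h3 : 2 * |c| * |a s| ^ 2 ≤ 2 * |a s| * H + B ^ 2 + |q| := by
      calc 2 * |c| * |a s| ^ 2 = |2 * c * a s ^ 2| := by simp [abs_mul]
        _ = |2 * a s * (n s + c * a s) + t s ^ 2 - q| := by rw [h2]
        _ ≤ |2 * a s * (n s + c * a s)| + |t s ^ 2| + |q| :=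
            (abs_sub _ _).trans (by gcongr; exact abs_add_le _ _)
        _ ≤ 2 * |a s| * H + B ^ 2 + |q| := by
            rw [abs_mul, abs_mul, abs_two, abs_pow]
            gcongr
            · exact habs s hs
            · exact hB s hs
    have h4 : 2 * |c| * |a s| ≤ 2 * H + B ^ 2 + |q| := by
      have h5 : B ^ 2 + |q| ≤ (B ^ 2 + |q|) * |a s| :=
        le_mul_of_one_le_right (by positivity) h1
      have h6 : |a s| * (2 * |c| * |a s|) ≤ |a s| * (2 * H + B ^ 2 + |q|) := by nlinarith
      exact le_of_mul_le_mul_left h6 (by linarith)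
    have h7 : |a s| ≤ (2 * H + B ^ 2 + |q|) / (2 * |c|) := by
      rw [le_div_iff₀ (by positivity)]; linarith
    linarith
  refine tendsto_zero_of_sq_integrable (L := (|c| + B) * A + (H + |c| * A))
    (fun s hs => h.dh (hI hs)) hm (fun s hs => h.dt s (hI hs)) fun s hs => ?_
  have hn : |n s| ≤ H + |c| * A := by
    calc |n s| = |(n s + c * a s) - c * a s| := by ring_nf
      _ ≤ |n s + c * a s| + |c| * |a s| := by rw [← abs_mul]; exact abs_sub _ _
      _ ≤ H + |c| * A := by gcongr; exacts [habs s hs, ha s hs]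
  calc |(c + t s) * a s - n s| ≤ |c + t s| * |a s| + |n s| := by
        rw [← abs_mul]; exact abs_sub _ _
    _ ≤ (|c| + B) * A + (H + |c| * A) := by
        gcongr
        · exact (abs_add_le _ _).trans (by gcongr; exact hB s hs)
        · exact ha s hs

/-- The sum of `ca` and `n` tends to `-∞` while their product stays bounded, so one tends to `-∞`
and the other remains bounded. If it were `n`, then `t' = ka - n` would make `t` unbounded. So `ca →
-∞` and `n → 0`, and `k' = ka - n` is dominated by `ka`, which rules out values of `k` away from
`0`. -/
theorem IsDataSolution.tendsto_of_not_bddBelow (h : IsDataSolution q c I a t n) (hc : c ≠ 0)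
    (hI : Ici s₀ ⊆ I) (hB : ∀ s, s₀ ≤ s → |t s| ≤ B)
    (hm : ¬ ∃ m, ∀ s, s₀ ≤ s → m ≤ n s + c * a s) : Tendsto (fun s => c + t s) atTop (𝓝 0) := by
  have hB0 : 0 ≤ B := (abs_nonneg _).trans (hB s₀ le_rfl)
  have hcpos : 0 < |c| := abs_pos.2 hc
  have hbot : Tendsto (fun s => n s + c * a s) atTop atBot := by
    refine tendsto_atBot.2 fun K => ?_
    push Not at hm
    obtain ⟨r, hr, hrK⟩ := hm K
    filter_upwards [eventually_ge_atTop r] with s hs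
    have := le_of_hasDerivAt_le (δ := 0) hs (fun x hx => h.dh (hI (le_trans hr hx.1)))
      fun x hx => by nlinarith [sq_nonneg (t x)]
    linarith
  set P := |c| * (|q| + B ^ 2) with hP
  have hP0 : 0 ≤ P := by positivity
  have hprod : ∀ s, s₀ ≤ s → |c * a s| * |n s| ≤ P := by
    intro s hs
    have h1 : 2 * ((c * a s) * n s) = c * (q - t s ^ 2) := by
      linear_combination c * h.quadric s (hI hs)
    have h2 : |c * (q - t s ^ 2)| ≤ P := by
      rw [abs_mul]
      refine mul_le_mul_of_nonneg_left ((abs_sub _ _).trans ?_) hcpos.le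
      rw [abs_pow]
      gcongr
      exact hB s hs
    rw [← h1, abs_mul, abs_two, abs_mul] at h2
    linarith [mul_nonneg (abs_nonneg (c * a s)) (abs_nonneg (n s))]
  obtain ⟨s₁, hs₁⟩ := eventually_atTop.1
    ((hbot.eventually_le_atBot (-(2 + 2 * P))).and (eventually_ge_atTop s₀))
  have hI₁ : Ici s₁ ⊆ I := fun s hs => hI (hs₁ s hs).2
  -- If the two terms were equal, each would be at most `-(1 + P)`, and their product would exceed
  -- `P`. Hence the smaller of them is the same throughout.
  have hne : ∀ s ∈ Ici s₁, n s - c * a s ≠ 0 := by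
    intro s hs h0
    have h1 := (hs₁ s hs).1
    have h2 := hprod s (hs₁ s hs).2
    rw [← sub_eq_zero.1 h0] at h1 h2
    rw [abs_mul_abs_self] at h2
    nlinarith
  have hcont : ContinuousOn (fun s => n s - c * a s) (Ici s₁) :=
    HasDerivAt.continuousOn fun s hs => (h.dn s (hI₁ hs)).sub ((h.da s (hI₁ hs)).const_mul c)
  have hsign : (∀ s ∈ Ici s₁, n s - c * a s < 0) ∨ ∀ s ∈ Ici s₁, 0 < n s - c * a s := by
    by_contra! hcon
    obtain ⟨⟨x, hx, hx0⟩, y, hy, hy0⟩ := hcon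
    obtain ⟨z, hz, hz0⟩ := isPreconnected_Ici.intermediate_value hy hx hcont ⟨hy0, hx0⟩
    exact hne z hz hz0
  rcases hsign with hsign | hsign
  · exfalso
    have ha : ∀ s, s₁ ≤ s → |a s| ≤ P / |c| := by
      intro s hs
      have h1 := hprod s (hs₁ s hs).2
      have h2 : 1 ≤ |n s| := by
        have := hsign s hs
        have := (hs₁ s hs).1
        rw [le_abs]; right; linarith
      rw [le_div_iff₀ hcpos, mul_comm, ← abs_mul]
      exact (le_mul_of_one_le_right (abs_nonneg _) h2).trans h1
    obtain ⟨s₂, hs₂⟩ := eventually_atTop.1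
      ((hbot.eventually_le_atBot (-(2 * ((|c| + B) * (P / |c|) + 1)))).and (eventually_ge_atTop s₁))
    have ht := tendsto_atTop_of_le_hasDerivAt one_pos
      (fun s hs => h.dt s (hI₁ (hs₂ s hs).2)) (a := s₂) fun s hs => by
        have h1 := (hs₂ s hs).1
        have h2 := hsign s (hs₂ s hs).2
        have h3 : |(c + t s) * a s| ≤ (|c| + B) * (P / |c|) := by
          rw [abs_mul]
          gcongr
          · exact (abs_add_le _ _).trans (by gcongr; exact hB s (hs₁ s (hs₂ s hs).2).2)
          · exact ha s (hs₂ s hs).2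
        linarith [(abs_le.1 h3).1]
    obtain ⟨s, hs, hs'⟩ := ((ht.eventually_gt_atTop B).and (eventually_ge_atTop s₀)).exists
    linarith [(abs_le.1 (hB s hs')).2]
  · rw [Metric.tendsto_nhds]
    intro e he
    set ε := e / 2 with hε
    have hε0 : 0 < ε := half_pos he
    -- The smaller term `ca` is at most half the sum. Of the bound obtained, `P / (ε / 2) + 1`
    -- forces `|n| ≤ ε / 2`, and `|c|` forces `|a| ≥ 1`.
    obtain ⟨s₂, hs₂⟩ := eventually_atTop.1
      ((hbot.eventually_le_atBot (-(2 * (P / (ε / 2) + 1 + |c|)))).and (eventually_ge_atTop s₁))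
    have hPε : 0 ≤ P / (ε / 2) := by positivity
    have hca : ∀ s, s₂ ≤ s → c * a s ≤ -(P / (ε / 2) + 1 + |c|) := fun s hs => by
      linarith [(hs₂ s hs).1, hsign s (hs₂ s hs).2]
    have hn : ∀ s, s₂ ≤ s → |n s| ≤ ε / 2 := by
      intro s hs
      have h1 := hprod s (hs₁ s (hs₂ s hs).2).2
      have h2 : P / (ε / 2) + 1 ≤ |c * a s| := by
        rw [le_abs]; right; linarith [hca s hs]
      have h3 : (P / (ε / 2) + 1) * |n s| ≤ P :=
        (mul_le_mul_of_nonneg_right h2 (abs_nonneg _)).trans h1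
      by_contra hcon
      have h4 : P / (ε / 2) * (ε / 2) = P := div_mul_cancel₀ _ (by positivity)
      nlinarith [abs_nonneg (n s)]
    have dk : ∀ s, s₂ ≤ s → HasDerivAt (fun s => (c + t s) ^ 2)
        (2 * (c + t s) * ((c + t s) * a s - n s)) s := fun s hs =>
      ((h.dk (hI₁ (hs₂ s hs).2)).pow 2).congr_deriv (by simp)
    -- Where `|k| ≥ ε`, `2|kn| ≤ ε|k| ≤ k²`. Since `|a| ≥ 1`, the derivative `2k²a - 2kn` of `k²`
    -- then has the sign of `a` and size at least `ε²`.
    have hkn : ∀ s, s₂ ≤ s → ε ^ 2 ≤ (c + t s) ^ 2 →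
        ε ^ 2 + 2 * |(c + t s) * n s| ≤ 2 * (c + t s) ^ 2 := by
      intro s hs hk
      have h1 : ε ≤ |c + t s| := by simpa [abs_of_pos hε0] using sq_le_sq.1 hk
      rw [abs_mul, ← sq_abs (c + t s)]
      nlinarith [mul_le_mul_of_nonneg_left (hn s hs) (abs_nonneg (c + t s))]
    suffices hle : ∀ᶠ s in atTop, (c + t s) ^ 2 ≤ ε ^ 2 by
      filter_upwards [hle] with s hs
      rw [Real.dist_eq, sub_zero]
      have := abs_le_of_sq_le_sq hs hε0.le
      exact lt_of_le_of_lt (abs_le.2 (abs_le.1 this)) (by linarith)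
    -- For `c < 0`, `a` is positive and `k²` would grow without bound from any value `≥ ε²`; for `c
    -- > 0`, `a` is negative and `k²` is driven below `ε²`.
    rcases lt_or_gt_of_ne hc with hc' | hc'
    · have h1 := lt_of_le_hasDerivAt_of_bounded (ε := ε ^ 2) (B := (|c| + B) ^ 2)
        (pow_pos hε0 2) dk ?_ ?_
      · filter_upwards [eventually_ge_atTop s₂] with s hs using (h1 s hs).le
      · intro s hs hk
        have h2 := hkn s hs hk
        have h3 : 1 ≤ a s := by
          have := hca s hs
          rw [abs_of_neg hc'] at this
          nlinarith
        nlinarith [le_abs_self ((c + t s) * n s),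
          mul_le_mul_of_nonneg_left h3 (sq_nonneg (c + t s))]
      · intro s hs
        refine sq_le_sq' ?_ ?_ <;>
        · have h3 := abs_le.1 ((abs_add_le c (t s)).trans
            (add_le_add_right (hB s (hs₁ s (hs₂ s hs).2).2) |c|))
          linarith
    · refine eventually_le_of_hasDerivAt_le (pow_pos hε0 2) dk fun s hs hk => ?_
      have h2 := hkn s hs hk
      have h3 : a s ≤ -1 := by
        have := hca s hs
        rw [abs_of_pos hc'] at this
        nlinarith
      nlinarith [neg_abs_le ((c + t s) * n s),
        mul_le_mul_of_nonneg_left h3 (sq_nonneg (c + t s))]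

/-- If the curvature is bounded near an infinite end, then it tends to `c` or to `0`. -/
theorem IsDataSolution.tendsto_of_bounded (h : IsDataSolution q c I a t n)
    (hreg : ∀ s ∈ I, IsRegularData c (a s) (t s) (n s)) (hI : Ici s₀ ⊆ I)
    (hB : ∀ s, s₀ ≤ s → |c + t s| ≤ B) :
    Tendsto (fun s => c + t s) atTop (𝓝 c) ∨ Tendsto (fun s => c + t s) atTop (𝓝 0) := by
  have hB' : ∀ s, s₀ ≤ s → |t s| ≤ B + |c| := fun s hs => by
    calc |t s| = |(c + t s) - c| := by ring_nf
      _ ≤ |c + t s| + |c| := abs_sub _ _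
      _ ≤ B + |c| := by gcongr; exact hB s hs
  have hadd : Tendsto t atTop (𝓝 0) → Tendsto (fun s => c + t s) atTop (𝓝 c) := fun ht => by
    simpa using ht.const_add c
  rcases eq_or_ne c 0 with rfl | hc
  · exact Or.inl (hadd (h.tendsto_of_zero hreg hI hB'))
  · by_cases hm : ∃ m, ∀ s, s₀ ≤ s → m ≤ n s + c * a s
    · obtain ⟨m, hm⟩ := hm
      exact Or.inl (hadd (h.tendsto_of_bddBelow hc hI hB' hm))
    · exact Or.inr (h.tendsto_of_not_bddBelow hc hI hB' hm)

end Data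

/-! ### Evolution by homotheties and isometries. -/

section SelfSimilar

/-- The determinant of three vectors. -/
def triple (u w z : Mink3) : ℝ :=
  u 0 * (w 1 * z 2 - w 2 * z 1) - u 1 * (w 0 * z 2 - w 2 * z 0) + u 2 * (w 0 * z 1 - w 1 * z 0)

/-- The matrix of the Lorentzian cross product with `v`: `⟨v × u, w⟩ = det(v, u, w)`. -/
def crossMatrix (v : Mink3) : Matrix (Fin 3) (Fin 3) ℝ :=
  !![0, v 2, -v 1; v 2, 0, -v 0; -v 1, v 0, 0]

theorem mink_crossMatrix (v u w : Mink3) : mink (crossMatrix v *ᵥ u) w = triple v u w := by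
  simp [mink, crossMatrix, triple, Matrix.mulVec, dotProduct, Fin.sum_univ_three]
  ring

theorem IsFrame.triple_sq {X T Y : Mink3} (h : IsFrame X T Y) : triple X T Y ^ 2 = 1 := by
  have : triple X T Y ^ 2 = -(mink X X * (mink T T * mink Y Y - mink T Y ^ 2) -
      mink X T * (mink X T * mink Y Y - mink T Y * mink X Y) +
      mink X Y * (mink X T * mink T Y - mink T T * mink X Y)) := by
    simp only [triple, mink]; ring
  rw [this, h.XX, h.XT, h.XY, h.TT, h.TY, h.YY]; norm_num

theorem IsFrame.triple_left {X T Y : Mink3} (h : IsFrame X T Y) (v : Mink3) :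
    triple v X Y = -(mink T v * triple X T Y) := by
  have hv := h.expand v
  rw [mink_comm v, mink_comm v, mink_comm v] at hv
  have hv' : ∀ i, v i = mink Y v * X i + mink T v * T i + mink X v * Y i := fun i => by
    simpa using congrFun hv i
  generalize mink Y v = y at *
  generalize mink T v = t at *
  generalize mink X v = x at *
  simp only [triple, hv']
  ring

theorem hasDerivAt_triple {u w z : ℝ → Mink3} {u' w' z' : Mink3} {s : ℝ} (hu : HasDerivAt u u' s)
    (hw : HasDerivAt w w' s) (hz : HasDerivAt z z' s) :
    HasDerivAt (fun s => triple (u s) (w s) (z s))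
      (triple u' (w s) (z s) + triple (u s) w' (z s) + triple (u s) (w s) z') s := by
  rw [hasDerivAt_pi] at hu hw hz
  have h := (((hu 0).mul (((hw 1).mul (hz 2)).sub ((hw 2).mul (hz 1)))).sub
    ((hu 1).mul (((hw 0).mul (hz 2)).sub ((hw 2).mul (hz 0))))).add
    ((hu 2).mul (((hw 0).mul (hz 1)).sub ((hw 1).mul (hz 0))))
  refine h.congr_deriv ?_
  simp only [triple, Pi.sub_apply, Pi.mul_apply]
  ring

variable {v : Mink3} {c : ℝ} {I : Set ℝ} {X T Y : ℝ → Mink3}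

/-- The coefficient matrix of the frame equations has trace zero, so the determinant of the frame is
constant. -/
theorem IsFrameSolution.triple_eq (h : IsFrameSolution v c I X T Y) {s₀ s : ℝ} (hs₀ : s₀ ∈ I)
    (hs : s ∈ I) : triple (X s) (T s) (Y s) = triple (X s₀) (T s₀) (Y s₀) := by
  have hd : ∀ r ∈ I, HasDerivAt (fun s => triple (X s) (T s) (Y s)) 0 r := fun r hr => by
    refine (hasDerivAt_triple (h.dX r hr) (h.dT r hr) (h.dY r hr)).congr_deriv ?_
    simp only [triple, Pi.sub_apply, Pi.smul_apply, smul_eq_mul]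
    ring
  exact h.interval.1.is_const_of_deriv_eq_zero h.interval.2.isPreconnected
    (fun r hr => (hd r hr).differentiableAt.differentiableWithinAt) (fun r hr => (hd r hr).deriv)
    hs hs₀

/-- The infinitesimal isometry with the flow along which the curve evolves. -/
theorem IsFrameSolution.exists_generator (h : IsFrameSolution v c I X T Y) :
    ∃ A : Matrix (Fin 3) (Fin 3) ℝ, (∀ u w, mink (A *ᵥ u) w + mink u (A *ᵥ w) = 0) ∧
      ∀ s ∈ I, mink (A *ᵥ X s) (Y s) = mink (T s) v := by
  obtain ⟨s₀, hs₀⟩ := h.interval.2.nonempty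
  -- The scalar is minus the orientation `±1` of the frame; it cancels the same sign in `det(v, X,
  -- Y) = -⟨T, v⟩ det(X, T, Y)`.
  refine ⟨(-triple (X s₀) (T s₀) (Y s₀)) • crossMatrix v, fun u w => ?_, fun s hs => ?_⟩
  · rw [mink_comm u, Matrix.smul_mulVec, Matrix.smul_mulVec, mink_smul_left, mink_smul_left,
      mink_crossMatrix, mink_crossMatrix]
    simp only [triple]
    ring
  · rw [Matrix.smul_mulVec, mink_smul_left, mink_crossMatrix, (h.frame s hs).triple_left v,
      h.triple_eq hs₀ hs]
    linear_combination mink (T s) v * (h.frame s₀ hs₀).triple_sq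

theorem exists_one_parameter_group (A : Matrix (Fin 3) (Fin 3) ℝ) :
    ∃ R : ℝ → Matrix (Fin 3) (Fin 3) ℝ, R 0 = 1 ∧ (∀ i j, ContDiff ℝ ∞ fun r => R r i j) ∧
      ∀ u r, HasDerivAt (fun r => R r *ᵥ u) (R r *ᵥ (A *ᵥ u)) r ∧
        R r *ᵥ (A *ᵥ u) = A *ᵥ (R r *ᵥ u) := by
  let _ : NormedRing (Matrix (Fin 3) (Fin 3) ℝ) := Matrix.linftyOpNormedRing
  let _ : NormedAlgebra ℝ (Matrix (Fin 3) (Fin 3) ℝ) := Matrix.linftyOpNormedAlgebra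
  have hd : ∀ r : ℝ, HasDerivAt (fun r : ℝ => NormedSpace.exp (r • A))
      (NormedSpace.exp (r • A) * A) r := fun r => hasDerivAt_exp_smul_const A r
  have hlin : ∀ u, IsLinearMap ℝ fun B : Matrix (Fin 3) (Fin 3) ℝ => B *ᵥ u := fun u =>
    ⟨fun B C => Matrix.add_mulVec B C u, fun a B => Matrix.smul_mulVec a B u⟩
  refine ⟨fun r => NormedSpace.exp (r • A), by simp, fun i j => ?_, fun u r => ⟨?_, ?_⟩⟩
  · have h1 : IsSolution (fun B => B * A) univ fun r : ℝ => NormedSpace.exp (r • A) :=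
      ⟨⟨isOpen_univ, isConnected_univ⟩, fun r _ => hd r⟩
    have h2 : ContDiff ℝ ∞ fun r : ℝ => NormedSpace.exp (r • A) :=
      contDiffOn_univ.1 (h1.contDiffOn (contDiff_id.mul contDiff_const))
    have hE : IsLinearMap ℝ fun B : Matrix (Fin 3) (Fin 3) ℝ => B i j :=
      ⟨fun B C => rfl, fun a B => rfl⟩
    exact hE.mk'.toContinuousLinearMap.contDiff.comp h2
  · have := ((hlin u).mk'.toContinuousLinearMap.hasFDerivAt).comp_hasDerivAt r (hd r)
    refine this.congr_deriv ?_
    exact (Matrix.mulVec_mulVec u (NormedSpace.exp (r • A)) A).symm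
  · have := (hd r).unique (hasDerivAt_exp_smul_const' A r)
    exact (Matrix.mulVec_mulVec u (NormedSpace.exp (r • A)) A).trans
      ((congrArg (· *ᵥ u) this).trans (Matrix.mulVec_mulVec u A (NormedSpace.exp (r • A))).symm)

/-- `f = √(1 + 2ct)` solves `f' = c / f`, and the group of `A` is run with the clock `θ' = 1 / f²`,
so that homothety and rotation both scale like curvature. The factor `1 / f` is kept for the inverse
flow. -/
theorem exists_evolution {A : Matrix (Fin 3) (Fin 3) ℝ}
    (hA : ∀ u w, mink (A *ᵥ u) w + mink u (A *ᵥ w) = 0) (c : ℝ) :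
    ∃ (J : Set ℝ) (f : ℝ → ℝ) (M : ℝ → Matrix (Fin 3) (Fin 3) ℝ), IsEvolution J f M ∧
      IsEvolution J (fun t => (f t)⁻¹) M ∧ (c = 0 → ∀ t ∈ J, f t = 1) ∧
      ∀ t ∈ J, HasDerivAt f (c / f t) t ∧
        ∀ u, HasDerivAt (fun t => M t *ᵥ u) ((f t ^ 2)⁻¹ • (M t *ᵥ (A *ᵥ u))) t := by
  obtain ⟨R, hR0, hRs, hR⟩ := exists_one_parameter_group A
  have hiso : ∀ r (u w : Mink3), mink (R r *ᵥ u) (R r *ᵥ w) = mink u w := by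
    intro r u w
    have hd : ∀ r, HasDerivAt (fun r => mink (R r *ᵥ u) (R r *ᵥ w)) 0 r := fun r => by
      refine (hasDerivAt_mink (hR u r).1 (hR w r).1).congr_deriv ?_
      rw [(hR u r).2, (hR w r).2, hA]
    have := is_const_of_deriv_eq_zero (fun r => (hd r).differentiableAt) (fun r => (hd r).deriv) r 0
    simpa [hR0] using this
  have hcont : ∀ p : Mink3, Continuous fun r => (R r *ᵥ p) 0 := fun p =>
    continuous_iff_continuousAt.2 fun r => (hasDerivAt_pi.1 (hR p r).1 0).continuousAt
  have hcone : ∀ r, IsConeIsometry (R r) := by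
    refine fun r => ⟨hiso r, fun p hp => ⟨by rw [hiso, hp.1], ?_⟩⟩
    -- The time coordinate of the moving null vector is positive at `r = 0` and cannot vanish, since
    -- an isometry does not kill `p`.
    by_contra hneg
    obtain ⟨z, -, hz⟩ := isPreconnected_univ.intermediate_value (mem_univ r) (mem_univ 0)
      (hcont p).continuousOn (show (0 : ℝ) ∈ Icc _ _ from ⟨not_lt.1 hneg, by
        simp only [hR0, Matrix.one_mulVec]; exact hp.2.le⟩)
    have h0 := eq_zero_of_null (p := R z *ᵥ p) (by rw [hiso, hp.1]) hz
    have h1 : ∀ w, mink p w = 0 := fun w => by rw [← hiso z, h0, mink_zero_left]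
    have h2 := h1 ![-1, 0, 0]
    simp [mink] at h2
    exact hp.2.ne' h2
  set J : Set ℝ := {t | 0 < 1 + 2 * c * t} with hJdef
  set θ : ℝ → ℝ := fun t => if c = 0 then t else Real.log (1 + 2 * c * t) / (2 * c) with hθ
  have h0J : (0 : ℝ) ∈ J := by simp [hJdef]
  have hJ : IsOpenInterval J := by
    refine .mk' (isOpen_lt continuous_const (by fun_prop)) ⟨fun x hx y hy z hz => ?_⟩ ⟨0, h0J⟩
    simp only [hJdef, mem_ofPred_eq] at *
    rcases le_total 0 c with hc | hc
    · nlinarith [mul_le_mul_of_nonneg_left hz.1 hc]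
    · nlinarith [mul_le_mul_of_nonpos_left hz.2 hc]
  have dlin : ∀ t, HasDerivAt (fun t => 1 + 2 * c * t) (2 * c) t := fun t => by
    simpa using ((hasDerivAt_id t).const_mul (2 * c)).const_add 1
  have slin : ContDiff ℝ ∞ fun t => 1 + 2 * c * t := by fun_prop
  have dθ : ∀ t ∈ J, HasDerivAt θ (1 + 2 * c * t)⁻¹ t := by
    intro t ht
    by_cases hc : c = 0
    · simpa [hθ, hc] using hasDerivAt_id' t
    · simp only [hθ, hc, if_false]
      refine (((dlin t).log (ne_of_gt ht)).div_const (2 * c)).congr_deriv ?_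
      field_simp
  have sθ : ContDiffOn ℝ ∞ θ J := by
    by_cases hc : c = 0
    · simpa [hθ, hc] using contDiff_fun_id.contDiffOn
    · simp only [hθ, hc, if_false]
      exact (slin.contDiffOn.log fun t ht => ne_of_gt ht).div_const _
  have hθ0 : θ 0 = 0 := by simp [hθ]
  have spos : ∀ t ∈ J, 0 < √(1 + 2 * c * t) := fun t ht => Real.sqrt_pos.2 ht
  have ssm : ContDiffOn ℝ ∞ (fun t => √(1 + 2 * c * t)) J :=
    slin.contDiffOn.sqrt fun t ht => ne_of_gt ht
  have hM : ∀ i j, ContDiffOn ℝ ∞ (fun t => R (θ t) i j) J := fun i j =>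
    (hRs i j).comp_contDiffOn sθ
  refine ⟨J, fun t => √(1 + 2 * c * t), fun t => R (θ t),
    ⟨hJ, h0J, ssm, spos, by simp, hM, fun t _ => hcone _, by rw [hθ0, hR0]⟩,
    ⟨hJ, h0J, ssm.inv fun t ht => (spos t ht).ne', fun t ht => inv_pos.2 (spos t ht), by simp, hM,
      fun t _ => hcone _, by rw [hθ0, hR0]⟩, fun hc t _ => by simp [hc], fun t ht => ⟨?_, fun u => ?_⟩⟩
  · refine ((dlin t).sqrt (ne_of_gt ht)).congr_deriv ?_
    rw [mul_div_mul_left _ _ two_ne_zero]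
  · rw [Real.sq_sqrt (le_of_lt ht)]
    exact HasDerivAt.scomp t (hR u (θ t)).1 (dθ t ht)

/-- A spacelike curve on the cone with a positive speed function, its unit tangent, its associated
curve and its curvature. -/
structure IsRegularCurve (I : Set ℝ) (X T Y : ℝ → Mink3) (σ κ : ℝ → ℝ) : Prop where
  interval : IsOpenInterval I
  smooth : ContDiffOn ℝ ∞ X I
  frame : ∀ s ∈ I, IsFrame (X s) (T s) (Y s)
  pos : ∀ s ∈ I, 0 < σ s
  dX : ∀ s ∈ I, HasDerivAt X (σ s • T s) s
  dT : ∀ s ∈ I, HasDerivAt T (σ s • (κ s • X s - Y s)) s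

variable {σ κ : ℝ → ℝ}

/-- A homothety by `r` multiplies the speed by `r`, the associated curve by `r⁻¹` and the curvature
by `r⁻²`; isometries change neither speed nor curvature. -/
theorem IsRegularCurve.isFramedCurve (h : IsRegularCurve I X T Y σ κ)
    {M : Matrix (Fin 3) (Fin 3) ℝ} (hM : IsConeIsometry M) {r : ℝ} (hr : 0 < r) :
    IsFramedCurve I (fun s => r • (M *ᵥ X s)) (fun s => M *ᵥ T s) (fun s => r⁻¹ • (M *ᵥ Y s))
      fun s => κ s / r ^ 2 := by
  have hF := fun s hs => (h.frame s hs).image hM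
  have hd : ∀ s ∈ I, deriv (fun s => r • (M *ᵥ X s)) s = (r * σ s) • (M *ᵥ T s) := fun s hs => by
    refine ((hasDerivAt_mulVec M (h.dX s hs)).const_smul r).deriv.trans ?_
    rw [Matrix.mulVec_smul, smul_smul]
  have hpos : ∀ s ∈ I, 0 < r * σ s := fun s hs => mul_pos hr (h.pos s hs)
  have hdd : ∀ s ∈ I, mink (deriv (fun s => r • (M *ᵥ X s)) s)
      (deriv (fun s => r • (M *ᵥ X s)) s) = (r * σ s) ^ 2 := fun s hs => by
    rw [hd s hs, mink_smul_left, mink_smul_right, (hF s hs).TT]; ring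
  have hsp : ∀ s ∈ I, speed (fun s => r • (M *ᵥ X s)) s = r * σ s := fun s hs => by
    rw [speed, hdd s hs, Real.sqrt_sq (hpos s hs).le]
  refine ⟨h.interval, ?_, fun s hs => ⟨?_, ?_⟩, fun s hs => ?_, fun s hs => ?_, fun s hs => ?_,
    fun s hs => ?_, fun s hs => ?_, fun s hs => ?_⟩
  · exact (M.mulVecLin.toContinuousLinearMap.contDiff.comp_contDiffOn h.smooth).const_smul r
  · simp [(hF s hs).XX]
  · simpa using mul_pos hr (hF s hs).pos
  · rw [hdd s hs]; exact pow_pos (hpos s hs) 2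
  · rw [hsp s hs, hd s hs, smul_smul, inv_mul_cancel₀ (hpos s hs).ne', one_smul]
  · simp [(hF s hs).YY]
  · simp [(hF s hs).TY]
  · simp [(hF s hs).XY, hr.ne']
  · rw [(hasDerivAt_mulVec M (h.dT s hs)).deriv, hsp s hs]
    simp only [Matrix.mulVec_smul, Matrix.mulVec_sub, smul_sub, smul_smul]
    congr 2 <;> field_simp

theorem IsEvolution.contDiffOn {J : Set ℝ} {f : ℝ → ℝ} {M : ℝ → Matrix (Fin 3) (Fin 3) ℝ}
    (h : IsEvolution J f M) (hX : ContDiffOn ℝ ∞ X I) :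
    ContDiffOn ℝ ∞ (fun p : ℝ × ℝ => f p.1 • (M p.1 *ᵥ X p.2)) (J ×ˢ I) := by
  rw [contDiffOn_pi]
  intro i
  have h1 : MapsTo Prod.fst (J ×ˢ I) J := fun p hp => hp.1
  have h2 : MapsTo Prod.snd (J ×ˢ I) I := fun p hp => hp.2
  have hf := h.smooth_f.comp contDiff_fst.contDiffOn h1
  have hMX : ∀ j, ContDiffOn ℝ ∞ (fun p : ℝ × ℝ => M p.1 i j * X p.2 j) (J ×ˢ I) := fun j =>
    ((h.smooth_M i j).comp contDiff_fst.contDiffOn h1).mul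
      ((contDiffOn_pi.1 hX j).comp contDiff_snd.contDiffOn h2)
  exact hf.mul (ContDiffOn.sum (s := Finset.univ) fun j _ => hMX j)

theorem IsRegularCurve.mink_deriv (h : IsRegularCurve I X T Y σ κ) {f : ℝ → ℝ} {f' g t : ℝ}
    {M : ℝ → Matrix (Fin 3) (Fin 3) ℝ} {A : Matrix (Fin 3) (Fin 3) ℝ} (hM : IsConeIsometry (M t))
    (hf : 0 < f t) (df : HasDerivAt f f' t)
    (dM : ∀ u, HasDerivAt (fun t => M t *ᵥ u) (g • (M t *ᵥ (A *ᵥ u))) t) {s : ℝ} (hs : s ∈ I) :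
    mink (deriv (fun r => f r • (M r *ᵥ X s)) t) ((f t)⁻¹ • (M t *ᵥ Y s)) =
      f' / f t + g * mink (A *ᵥ X s) (Y s) := by
  have hd : deriv (fun r => f r • (M r *ᵥ X s)) t = _ := (df.smul (dM (X s))).deriv
  rw [hd]
  simp only [mink_add_left, mink_smul_left, mink_smul_right, hM.1, (h.frame s hs).XY]
  field_simp
  ring

theorem IsFrameSolution.isSelfSimilarCF (h : IsFrameSolution v c I X T Y) :
    IsSelfSimilarCF I X ∧ (c = 0 → IsSolitonCF I X) := by
  obtain ⟨A, hA, hAX⟩ := h.exists_generator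
  obtain ⟨J, f, M, hev, -, hf1, hd⟩ := exists_evolution hA c
  have hreg : IsRegularCurve I X T Y (fun _ => 1) fun s => c + mink (T s) v :=
    ⟨h.interval, h.contDiffOn.1, h.frame, fun _ _ => one_pos,
      fun s hs => by simpa using h.dX s hs, fun s hs => by simpa using h.dT s hs⟩
  have hsol : IsCFSolution I J X fun t s => f t • (M t *ᵥ X s) := by
    refine ⟨hev.contDiffOn h.contDiffOn.1, fun s _ => by simp [hev.f_zero, hev.M_zero],
      fun t ht => ⟨_, _, _, hreg.isFramedCurve (hev.isometry t ht) (hev.pos t ht), fun s hs => ?_⟩⟩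
    have hpos := hev.pos t ht
    rw [hreg.mink_deriv (hev.isometry t ht) hpos (hd t ht).1 (hd t ht).2 hs, hAX s hs]
    field_simp
  exact ⟨⟨J, f, M, hev, hsol⟩, fun hc => ⟨J, f, M, hev, hf1 hc, hsol⟩⟩

theorem IsFrameSolution.isSelfSimilarICF (h : IsFrameSolution v c I X T Y) {k : ℝ → ℝ}
    (hk : ∀ s ∈ I, k s = c + mink (T s) v) {s₀ : ℝ} (hs₀ : s₀ ∈ regularSet I k) :
    IsSelfSimilarICF (connectedComponentIn (regularSet I k) s₀) fun s => -Y s := by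
  have hTs := h.contDiffOn.2.1
  have hkc : ContinuousOn k I := by
    refine ContinuousOn.congr ?_ hk
    exact continuousOn_const.add
      ((contDiff_mink (n := 0)).continuous.comp_continuousOn (hTs.continuousOn.prodMk continuousOn_const))
  have hopen : IsOpen (regularSet I k) := hkc.isOpen_inter_preimage h.interval.1 isOpen_ne
  set C := connectedComponentIn (regularSet I k) s₀ with hC
  have hCI : C ⊆ regularSet I k := connectedComponentIn_subset _ _
  have hCint : IsOpenInterval C :=
    ⟨hopen.connectedComponentIn, isConnected_connectedComponentIn_iff.2 hs₀⟩
  -- `e` is the constant sign of `k` on the component. As `(-Y)' = kT`, the unit tangent of `-Y` is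
  -- `eT` and its speed is `ek`.
  obtain ⟨e, he, hek⟩ : ∃ e : ℝ, (e = 1 ∨ e = -1) ∧ ∀ s ∈ C, 0 < e * k s := by
    by_contra! hcon
    obtain ⟨x, hx, hx0⟩ := hcon 1 (Or.inl rfl)
    obtain ⟨y, hy, hy0⟩ := hcon (-1) (Or.inr rfl)
    obtain ⟨z, hz, hz0⟩ := hCint.2.isPreconnected.intermediate_value hx hy
      (hkc.mono fun s hs => (hCI hs).1) (show (0 : ℝ) ∈ Icc _ _ from ⟨by linarith, by linarith⟩)
    exact (hCI hz).2 hz0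
  have hframe : ∀ s ∈ C, IsFrame (-Y s) (e • T s) (-X s) := fun s hs => by
    have := (h.frame s (hCI hs).1).swap
    rcases he with rfl | rfl
    · simpa using this
    · simpa using this.neg
  have hee : e * e = 1 := by rcases he with rfl | rfl <;> norm_num
  have hreg : IsRegularCurve C (fun s => -Y s) (fun s => e • T s) (fun s => -X s)
      (fun s => e * k s) fun s => (k s)⁻¹ := by
    refine ⟨hCint, (h.contDiffOn.2.2.mono fun s hs => (hCI hs).1).neg, hframe, hek,
      fun s hs => ?_, fun s hs => ?_⟩
    · refine (h.dY s (hCI hs).1).neg.congr_deriv ?_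
      rw [← hk s (hCI hs).1, smul_smul, neg_smul, neg_neg, mul_right_comm, hee, one_mul]
    · refine ((h.dT s (hCI hs).1).const_smul e).congr_deriv ?_
      rw [← hk s (hCI hs).1]
      have hk0 := (hCI hs).2
      simp only [smul_sub, smul_neg, smul_smul, mul_assoc, mul_inv_cancel₀ hk0]
      rw [mul_one, sub_neg_eq_add, neg_add_eq_sub]
  obtain ⟨A, hA, hAX⟩ := h.exists_generator
  obtain ⟨J, f, M, hev', hev, -, hd⟩ := exists_evolution hA c
  refine ⟨J, fun t => (f t)⁻¹, M, hev, hev.contDiffOn hreg.smooth,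
    fun s _ => by simp only [hev.f_zero, hev.M_zero, one_smul, Matrix.one_mulVec],
    fun t ht => ⟨_, _, _, hreg.isFramedCurve (hev.isometry t ht) (hev.pos t ht), fun s hs => ?_⟩⟩
  have hpos := hev'.pos t ht
  have hk0 := (hCI hs).2
  refine ⟨by positivity, ?_⟩
  rw [hreg.mink_deriv (f := fun t => (f t)⁻¹) (hev.isometry t ht) (hev.pos t ht)
    ((hd t ht).1.inv hpos.ne') (hd t ht).2 hs]
  have h1 : mink (A *ᵥ -Y s) (-X s) = -mink (T s) v := by
    have := hA (Y s) (X s)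
    rw [mink_comm (Y s), hAX s (hCI hs).1] at this
    simp only [Matrix.mulVec_neg, mink_neg_left, mink_neg_right]
    linarith
  rw [h1, show mink (T s) v = k s - c by rw [hk s (hCI hs).1]; ring]
  field_simp
  ring

end SelfSimilar

/-! ### The parameter space as a regular surface. -/

section Surface

/-- A smooth section of a linear projection is a chart: the projection is the continuous inverse,
and by the chain rule it is a left inverse of the differential. -/
theorem exists_chart {S : Set (ℝ × ℝ × ℝ)} {p : ℝ × ℝ × ℝ} {U : Set (ℝ × ℝ)}
    {V : Set (ℝ × ℝ × ℝ)} {φ : ℝ × ℝ → ℝ × ℝ × ℝ} (L : ℝ × ℝ × ℝ →L[ℝ] ℝ × ℝ) (hU : IsOpen U)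
    (hV : IsOpen V) (hp : p ∈ V) (hφ : ContDiffOn ℝ ∞ φ U) (hLφ : ∀ u ∈ U, L (φ u) = u)
    (h1 : ∀ u ∈ U, φ u ∈ V ∩ S) (h2 : ∀ r ∈ V ∩ S, L r ∈ U ∧ φ (L r) = r) :
    ∃ (U : Set (ℝ × ℝ)) (V : Set (ℝ × ℝ × ℝ)) (φ : ℝ × ℝ → ℝ × ℝ × ℝ) (ψ : ℝ × ℝ × ℝ → ℝ × ℝ),
      IsOpen U ∧ IsOpen V ∧ p ∈ V ∧ φ '' U = V ∩ S ∧
      ContDiffOn ℝ ∞ φ U ∧ (∀ u ∈ U, Function.Injective (fderiv ℝ φ u)) ∧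
      ContinuousOn ψ (V ∩ S) ∧ ∀ u ∈ U, ψ (φ u) = u := by
  refine ⟨U, V, φ, L, hU, hV, hp, ?_, hφ, fun u hu => ?_, L.continuous.continuousOn, hLφ⟩
  · exact Subset.antisymm (image_subset_iff.2 h1) fun r hr => ⟨L r, h2 r hr⟩
  · have hd : HasFDerivAt φ (fderiv ℝ φ u) u :=
      ((hφ.contDiffAt (hU.mem_nhds hu)).differentiableAt (by simp)).hasFDerivAt
    have hid : HasFDerivAt (fun u => L (φ u)) (ContinuousLinearMap.id ℝ (ℝ × ℝ)) u :=
      (hasFDerivAt_id u).congr_of_eventuallyEq (eventually_of_mem (hU.mem_nhds hu) hLφ)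
    have heq := (L.hasFDerivAt.comp u hd).unique hid
    exact Function.LeftInverse.injective (g := L) fun w => DFunLike.congr_fun heq w

theorem IsRegularSurface.inter_isOpen {S O : Set (ℝ × ℝ × ℝ)} (hS : IsRegularSurface S)
    (hO : IsOpen O) : IsRegularSurface (S ∩ O) := by
  rintro p ⟨hpS, hpO⟩
  obtain ⟨U, V, φ, ψ, hU, hV, hp, him, hφ, hinj, hψ, hψφ⟩ := hS p hpS
  refine ⟨U ∩ φ ⁻¹' O, V ∩ O, φ, ψ, hφ.continuousOn.isOpen_inter_preimage hU hO, hV.inter hO,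
    ⟨hp, hpO⟩, ?_, hφ.mono inter_subset_left, fun u hu => hinj u hu.1,
    hψ.mono fun r hr => ⟨hr.1.1, hr.2.1⟩, fun u hu => hψφ u hu.1⟩
  rw [image_inter_preimage, him]
  ext r
  simp only [mem_inter_iff]
  tauto

/-- Near each point the quadric is a graph: solve for `η` if `α ≠ 0`, for `α` if `η ≠ 0`, and
otherwise for `τ`, which is then nonzero and keeps its sign `e`. In the first two charts the sign of
the denominator keeps the graph on the same sheet or nappe. -/
theorem isRegularSurface_dataSurface {v : Mink3} (hv : v ≠ 0) :
    IsRegularSurface (dataSurface v) := by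
  rintro ⟨a₀, t₀, n₀⟩ hp
  obtain ⟨hq, hc⟩ := hp
  simp only at hq hc
  by_cases ha : a₀ = 0
  · by_cases hn : n₀ = 0
    · have hq' : t₀ ^ 2 = mink v v := by rw [← hq, ha]; ring
      have ht : t₀ ≠ 0 := by
        rintro rfl
        rcases hc with h | h | h
        · simp [ha] at h
        · exact h.2.1 (by simp [ha, hn])
        · rw [← hq'] at h; simp at h
      have hpos : 0 < mink v v := by rw [← hq']; positivity
      obtain ⟨e, hee, het⟩ : ∃ e : ℝ, e * e = 1 ∧ 0 < e * t₀ := by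
        rcases lt_or_gt_of_ne ht with h | h
        · exact ⟨-1, by norm_num, by linarith⟩
        · exact ⟨1, by norm_num, by linarith⟩
      refine exists_chart (U := {u | 0 < mink v v - 2 * u.1 * u.2}) (V := {r | 0 < e * r.2.1})
        (φ := fun u => (u.1, e * √(mink v v - 2 * u.1 * u.2), u.2))
        ((ContinuousLinearMap.fst ℝ ℝ (ℝ × ℝ)).prod
          ((ContinuousLinearMap.snd ℝ ℝ ℝ).comp (ContinuousLinearMap.snd ℝ ℝ (ℝ × ℝ))))
        (isOpen_lt continuous_const (by fun_prop)) (isOpen_lt continuous_const (by fun_prop)) het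
        ?_ (fun u _ => rfl) (fun u hu => ?_) fun r hr => ?_
      · have h1 : ContDiff ℝ ∞ fun u : ℝ × ℝ => mink v v - 2 * u.1 * u.2 := by fun_prop
        exact contDiff_fst.contDiffOn.prodMk ((contDiffOn_const.mul
          (h1.contDiffOn.sqrt fun u hu => ne_of_gt hu)).prodMk contDiff_snd.contDiffOn)
      · have hs := Real.sqrt_pos.2 (show 0 < mink v v - 2 * u.1 * u.2 from hu)
        have hsq := Real.sq_sqrt (le_of_lt (show 0 < mink v v - 2 * u.1 * u.2 from hu))
        refine ⟨?_, ?_, Or.inr (Or.inr hpos)⟩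
        · simp only [mem_ofPred_eq, ← mul_assoc, hee, one_mul]
          exact hs
        · simp only [mul_pow, hsq, sq e, hee]
          ring
      · obtain ⟨hr1, hr2, -⟩ := hr
        simp only [mem_ofPred_eq] at hr1
        have h1 : mink v v - 2 * r.1 * r.2.2 = (e * r.2.1) ^ 2 := by
          rw [mul_pow, sq e, hee, ← hr2]; ring
        refine ⟨?_, ?_⟩
        · show 0 < mink v v - 2 * r.1 * r.2.2
          rw [h1]
          exact pow_pos hr1 2
        · simp [h1, Real.sqrt_sq hr1.le, ← mul_assoc, hee]
    · refine exists_chart (U := {u | 0 < u.1 * n₀}) (V := {r | 0 < r.2.2 * n₀})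
        (φ := fun u => ((mink v v - u.2 ^ 2) / (2 * u.1), u.2, u.1))
        (((ContinuousLinearMap.snd ℝ ℝ ℝ).comp (ContinuousLinearMap.snd ℝ ℝ (ℝ × ℝ))).prod
          ((ContinuousLinearMap.fst ℝ ℝ ℝ).comp (ContinuousLinearMap.snd ℝ ℝ (ℝ × ℝ))))
        (isOpen_lt continuous_const (by fun_prop)) (isOpen_lt continuous_const (by fun_prop))
        (mul_self_pos.2 hn) ?_ (fun u _ => rfl) (fun u hu => ?_) fun r hr => ?_
      · refine ContDiffOn.prodMk ?_ (contDiff_snd.prodMk contDiff_fst).contDiffOn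
        refine ContDiffOn.div (by fun_prop) (by fun_prop) fun u hu h0 => ?_
        have hu : 0 < u.1 * n₀ := hu
        rw [show u.1 = 0 by linarith, zero_mul] at hu
        exact lt_irrefl _ hu
      · have hu : 0 < u.1 * n₀ := hu
        have hu0 : u.1 ≠ 0 := fun h0 => by simp [h0] at hu
        have hquad : 2 * ((mink v v - u.2 ^ 2) / (2 * u.1)) * u.1 + u.2 ^ 2 = mink v v := by
          field_simp; ring
        refine ⟨hu, hquad, ?_⟩
        rcases hc with h | h | h
        · simp [ha] at h
        · have h0 : 0 < v 0 * n₀ := lt_of_le_of_ne h.2.2.2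
            (mul_ne_zero (time_ne_zero_of_null hv h.1) hn).symm
          have h1 : 0 < v 0 * u.1 := by
            have := mul_pos h0 hu
            rw [show v 0 * n₀ * (u.1 * n₀) = v 0 * u.1 * n₀ ^ 2 by ring] at this
            exact pos_of_mul_pos_left this (sq_nonneg _)
          refine Or.inr (Or.inl ⟨h.1, fun e => hu0 (congrArg (fun r => r.2.2) e), ?_, h1.le⟩)
          have : v 0 * ((mink v v - u.2 ^ 2) / (2 * u.1)) =
              -((v 0 * u.1) * u.2 ^ 2 / (2 * u.1 ^ 2)) := by
            rw [h.1]; field_simp; ring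
          rw [this]
          exact neg_nonpos.2 (by positivity)
        · exact Or.inr (Or.inr h)
      · obtain ⟨hr1, hr2, -⟩ := hr
        have hr1 : 0 < r.2.2 * n₀ := hr1
        have hr0 : r.2.2 ≠ 0 := fun h0 => by simp [h0] at hr1
        refine ⟨hr1, Prod.ext ?_ rfl⟩
        simp only [ContinuousLinearMap.prod_apply, ContinuousLinearMap.comp_apply,
          ContinuousLinearMap.coe_fst', ContinuousLinearMap.coe_snd']
        rw [← hr2]
        field_simp
        ring
  · refine exists_chart (U := {u | 0 < u.1 * a₀}) (V := {r | 0 < r.1 * a₀})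
      (φ := fun u => (u.1, u.2, (mink v v - u.2 ^ 2) / (2 * u.1)))
      ((ContinuousLinearMap.fst ℝ ℝ (ℝ × ℝ)).prod
        ((ContinuousLinearMap.fst ℝ ℝ ℝ).comp (ContinuousLinearMap.snd ℝ ℝ (ℝ × ℝ))))
      (isOpen_lt continuous_const (by fun_prop)) (isOpen_lt continuous_const (by fun_prop))
      (mul_self_pos.2 ha) ?_ (fun u _ => rfl) (fun u hu => ?_) fun r hr => ?_
    · refine contDiff_fst.contDiffOn.prodMk (contDiff_snd.contDiffOn.prodMk ?_)
      refine ContDiffOn.div (by fun_prop) (by fun_prop) fun u hu h0 => ?_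
      have hu : 0 < u.1 * a₀ := hu
      rw [show u.1 = 0 by linarith, zero_mul] at hu
      exact lt_irrefl _ hu
    · have hu : 0 < u.1 * a₀ := hu
      have hu0 : u.1 ≠ 0 := fun h0 => by simp [h0] at hu
      have hquad : 2 * u.1 * ((mink v v - u.2 ^ 2) / (2 * u.1)) + u.2 ^ 2 = mink v v := by
        field_simp; ring
      have hneg : v 0 * a₀ < 0 → v 0 * u.1 < 0 := fun h0 => by
        have := mul_neg_of_neg_of_pos h0 hu
        rw [show v 0 * a₀ * (u.1 * a₀) = v 0 * u.1 * a₀ ^ 2 by ring] at this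
        exact neg_of_mul_neg_left this (sq_nonneg _)
      refine ⟨hu, hquad, ?_⟩
      rcases hc with h | h | h
      · exact Or.inl ⟨h.1, hneg h.2⟩
      · have h1 := hneg (lt_of_le_of_ne h.2.2.1 (mul_ne_zero (time_ne_zero_of_null hv h.1) ha))
        refine Or.inr (Or.inl ⟨h.1, fun e => hu0 (congrArg (fun r => r.1) e), h1.le, ?_⟩)
        have : v 0 * ((mink v v - u.2 ^ 2) / (2 * u.1)) =
            -(v 0 * u.1) * u.2 ^ 2 / (2 * u.1 ^ 2) := by
          rw [h.1]; field_simp; ring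
        have h2 : 0 < -(v 0 * u.1) := neg_pos.2 h1
        simp only [this]
        positivity
      · exact Or.inr (Or.inr h)
    · obtain ⟨hr1, hr2, -⟩ := hr
      have hr1 : 0 < r.1 * a₀ := hr1
      have hr0 : r.1 ≠ 0 := fun h0 => by simp [h0] at hr1
      refine ⟨hr1, Prod.ext rfl (Prod.ext rfl ?_)⟩
      simp only [ContinuousLinearMap.prod_apply, ContinuousLinearMap.comp_apply,
        ContinuousLinearMap.coe_fst', ContinuousLinearMap.coe_snd']
      rw [← hr2]
      field_simp
      ring

theorem isRegularSurface_parameterSurface {v : Mink3} (hv : v ≠ 0) (c : ℝ) :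
    IsRegularSurface (parameterSurface v c) := by
  have h1 : IsOpen {p : ℝ × ℝ × ℝ | ¬ (p.2.1 = 0 ∧ p.2.2 = c * p.1)} :=
    ((isClosed_eq (by fun_prop) continuous_const).inter
      (isClosed_eq (by fun_prop) (by fun_prop))).isOpen_compl
  have h2 : IsOpen {p : ℝ × ℝ × ℝ | ¬ (p.2.1 = -c ∧ p.2.2 = 0)} :=
    ((isClosed_eq (by fun_prop) continuous_const).inter
      (isClosed_eq (by fun_prop) continuous_const)).isOpen_compl
  exact (isRegularSurface_dataSurface hv).inter_isOpen (h1.inter h2)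

theorem parameterSurface_nonempty {v : Mink3} (hv : v ≠ 0) (c : ℝ) :
    (parameterSurface v c).Nonempty := by
  -- Both families of excluded triples have `τ ∈ {0, -c}`, so any other value of `τ` avoids them.
  obtain ⟨t, ht0, htc⟩ : ∃ t : ℝ, t ≠ 0 ∧ t ≠ -c := by
    rcases eq_or_ne c (-1) with rfl | h
    · exact ⟨2, by norm_num, by norm_num⟩
    · exact ⟨1, one_ne_zero, fun e => h (by linarith)⟩
  suffices H : ∃ p ∈ dataSurface v, p.2.1 = t by
    obtain ⟨p, hp, hpt⟩ := H
    exact ⟨p, hp, fun h => ht0 (hpt ▸ h.1), fun h => htc (hpt ▸ h.1)⟩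
  by_cases h0 : v 0 = 0
  · refine ⟨(1, t, (mink v v - t ^ 2) / 2), ⟨by simp only; ring, Or.inr (Or.inr ?_)⟩, rfl⟩
    by_contra hcon
    have h00 : v 0 * v 0 = 0 := by rw [h0, zero_mul]
    refine hv (eq_zero_of_null (le_antisymm (not_lt.1 hcon) ?_) h0)
    simp only [mink]
    nlinarith [mul_self_nonneg (v 1), mul_self_nonneg (v 2)]
  · have hpos := mul_self_pos.2 h0
    refine ⟨(-v 0, t, (mink v v - t ^ 2) / (2 * -v 0)), ⟨by simp only; field_simp; ring, ?_⟩, rfl⟩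
    rcases lt_trichotomy (mink v v) 0 with hq | hq | hq
    · exact Or.inl ⟨hq, by simp only; linarith⟩
    · refine Or.inr (Or.inl ⟨hq, fun e => h0 (neg_eq_zero.1 (congrArg (fun r => r.1) e)),
        by simp only; linarith, ?_⟩)
      have : v 0 * ((mink v v - t ^ 2) / (2 * -v 0)) = t ^ 2 / 2 := by
        rw [hq]; field_simp; ring
      simp only [this]
      positivity
    · exact Or.inr (Or.inr hq)

end Surface

/-! ### Ends of maximal curves, uniqueness of `v`, and the theorem. -/

section Main

variable {v : Mink3} {c : ℝ} {I : Set ℝ} {X T Y : ℝ → Mink3} {k : ℝ → ℝ}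

theorem IsFrameSolution.isDataSolution (h : IsFrameSolution v c I X T Y) :
    IsDataSolution (mink v v) c I (fun s => mink (X s) v) (fun s => mink (T s) v)
      fun s => mink (Y s) v :=
  ⟨h.interval, fun s hs => hasDerivAt_mink_const (h.dX s hs) v,
    fun s hs => (hasDerivAt_mink_const (h.dT s hs) v).congr_deriv (by simp),
    fun s hs => (hasDerivAt_mink_const (h.dY s hs) v).congr_deriv (by
      rw [mink_smul_left]; ring),
    fun s hs => (h.frame s hs).data_quadric v⟩

theorem IsFrameSolution.regular (h : IsFrameSolution v c I X T Y)
    (hne : ¬ ∃ e, ∀ s ∈ I, mink (T s) v = e) {s : ℝ} (hs : s ∈ I) :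
    IsRegularData c (mink (X s) v) (mink (T s) v) (mink (Y s) v) := by
  by_contra hcon
  exact hne (h.isDataSolution.const_of_not_regular hs hcon)

theorem IsMaximalFrame.endAlternative_atTop (h : IsMaximalFrame v c I X T Y)
    (hne : ¬ ∃ e, ∀ s ∈ I, mink (T s) v = e) :
    EndAlternative c (fun s => c + mink (T s) v) (atTop : Filter I) := by
  have : Nonempty I := h.sol.interval.2.nonempty.to_subtype
  by_cases hB : ∃ B : ℝ, ∀ᶠ s : I in atTop, |c + mink (T s) v| ≤ B
  · right
    obtain ⟨B, hB⟩ := hB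
    obtain ⟨⟨a, ha⟩, hB⟩ := eventually_atTop.1 hB
    have hB' : ∀ s ∈ I, a ≤ s → |c + mink (T s) v| ≤ B := fun s hs has => hB ⟨s, hs⟩ has
    have hunb := not_bddAbove_iff.1 (h.not_bddAbove ha hB')
    have hI : Ici a ⊆ I := fun s hs => by
      obtain ⟨y, hy, hsy⟩ := hunb s
      exact h.sol.interval.ordConnected.out ha hy ⟨hs, hsy.le⟩
    have hval : Tendsto (Subtype.val : I → ℝ) atTop atTop := by
      refine tendsto_atTop_atTop.2 fun b => ?_
      obtain ⟨y, hy, hby⟩ := hunb b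
      exact ⟨⟨y, hy⟩, fun s hs => hby.le.trans hs⟩
    rcases h.sol.isDataSolution.tendsto_of_bounded (fun s hs => h.sol.regular hne hs) hI
      fun s hs => hB' s (hI hs) hs with h1 | h1
    · exact Or.inl (h1.comp hval)
    · exact Or.inr (h1.comp hval)
  · exact Or.inl hB

/-- Parameter reversal, which preserves `k` and `c`, exchanges the two ends. -/
theorem IsMaximalFrame.endAlternative_atBot (h : IsMaximalFrame v c I X T Y)
    (hne : ¬ ∃ e, ∀ s ∈ I, mink (T s) v = e) :
    EndAlternative c (fun s => c + mink (T s) v) (atBot : Filter I) := by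
  have hrev := h.reverse.endAlternative_atTop fun ⟨e, he⟩ =>
    hne ⟨e, fun s hs => by simpa using he (-s) (by simpa using hs)⟩
  simp only [mink_neg_left, mink_neg_right, neg_neg] at hrev
  have : Nonempty I := h.sol.interval.2.nonempty.to_subtype
  have : Nonempty ((fun s : ℝ => -s) ⁻¹' I) := h.reverse.sol.interval.2.nonempty.to_subtype
  let e : I → (fun s : ℝ => -s) ⁻¹' I := fun s => ⟨-s, by simp⟩
  let e' : (fun s : ℝ => -s) ⁻¹' I → I := fun s => ⟨-s, s.2⟩
  have he : Tendsto e atBot atTop := tendsto_atBot_atTop.2 fun b =>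
    ⟨e' b, fun s hs => le_neg.1 (show (s : ℝ) ≤ -b from hs)⟩
  have he' : Tendsto e' atTop atBot := tendsto_atTop_atBot.2 fun b =>
    ⟨e b, fun s hs => neg_le.1 (show -(b : ℝ) ≤ s from hs)⟩
  rcases hrev with h1 | h1 | h1
  · exact Or.inl fun ⟨B, hB⟩ => h1 ⟨B, he'.eventually hB⟩
  · refine Or.inr (Or.inl ((h1.comp he).congr fun s => ?_))
    simp [e]
  · refine Or.inr (Or.inr ((h1.comp he).congr fun s => ?_))
    simp [e]

theorem EndAlternative.congr {k' : ℝ → ℝ} {l : Filter I} (h : EndAlternative c k l)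
    (hk : ∀ s ∈ I, k' s = k s) : EndAlternative c k' l := by
  have hk' : ∀ s : I, k' s = k s := fun s => hk s s.2
  simpa only [EndAlternative, hk'] using h

/-- The vector `v` is determined by a non-trivial curve and the constant `c`. -/
theorem IsFrameSolution.vector_unique (h : IsFrameSolution v c I X T Y)
    (hne : ¬ ∃ e, ∀ s ∈ I, mink (T s) v = e) {v' : Mink3}
    (hv' : ∀ s ∈ I, mink (T s) v' = mink (T s) v) : v' = v := by
  have hn : ∀ s ∈ I, I ∈ 𝓝 s := fun s hs => h.interval.1.mem_nhds hs
  -- With `w = v' - v`, differentiating `⟨T, w⟩ = 0` twice gives `k⟨X, w⟩ = ⟨Y, w⟩` and then `k'⟨X,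
  -- w⟩ = 0`. At a point with `k' ≠ 0` all three products vanish, so `w = 0`.
  have hT : ∀ s ∈ I, mink (T s) (v' - v) = 0 := fun s hs => by simp [hv' s hs]
  have hY : ∀ s ∈ I, (c + mink (T s) v) * mink (X s) (v' - v) - mink (Y s) (v' - v) = 0 :=
    fun s hs => by
      have := (hasDerivAt_mink_const (h.dT s hs) (v' - v)).unique
        ((hasDerivAt_const s (0 : ℝ)).congr_of_eventuallyEq (eventually_of_mem (hn s hs) hT))
      rwa [mink_sub_left, mink_smul_left] at this
  have hd := h.isDataSolution
  have hX : ∀ s ∈ I, ((c + mink (T s) v) * mink (X s) v - mink (Y s) v) *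
      mink (X s) (v' - v) = 0 := fun s hs => by
    have := (((hd.dk hs).mul (hasDerivAt_mink_const (h.dX s hs) (v' - v))).sub
      (hasDerivAt_mink_const (h.dY s hs) (v' - v))).unique
      ((hasDerivAt_const s (0 : ℝ)).congr_of_eventuallyEq (eventually_of_mem (hn s hs) hY))
    simpa only [mink_smul_left, hT s hs, mul_zero, add_zero, sub_zero] using this
  obtain ⟨s, hs, hs0⟩ : ∃ s ∈ I, (c + mink (T s) v) * mink (X s) v - mink (Y s) v ≠ 0 := by
    by_contra! hcon
    obtain ⟨s₀, hs₀⟩ := h.interval.2.nonempty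
    refine hne ⟨mink (T s₀) v, fun s hs => ?_⟩
    exact h.interval.1.is_const_of_deriv_eq_zero h.interval.2.isPreconnected
      (fun r hr => (hd.dt r hr).differentiableAt.differentiableWithinAt)
      (fun r hr => (hd.dt r hr).deriv.trans (hcon r hr)) hs hs₀
  have hX0 := (mul_eq_zero.1 (hX s hs)).resolve_left hs0
  have hY0 := hY s hs
  rw [hX0, mul_zero, zero_sub, neg_eq_zero] at hY0
  exact sub_eq_zero.1 ((h.frame s hs).eq_zero hX0 (hT s hs) hY0)

end Main

end LightCone

theorem theorem1p6 (v : LightCone.Mink3) (hv : v ≠ 0) (c : ℝ) :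
    -- the curves form a family with two parameters
    ((LightCone.parameterSurface v c).Nonempty ∧
      LightCone.IsRegularSurface (LightCone.parameterSurface v c)) ∧
    -- each parameter value is attained by a non-trivial curve, unique up to isometries fixing `v`
    (∀ p ∈ LightCone.parameterSurface v c,
      ∃ (I : Set ℝ) (X T Y : ℝ → LightCone.Mink3) (k : ℝ → ℝ),
        (0 : ℝ) ∈ I ∧ LightCone.IsMaximalCurveFor v c I X T Y k ∧
        ¬ LightCone.IsTrivialCurve I k ∧ LightCone.frameData v X T Y 0 = p ∧
        ∀ (I' : Set ℝ) (X' T' Y' : ℝ → LightCone.Mink3) (k' : ℝ → ℝ),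
          (0 : ℝ) ∈ I' → LightCone.IsMaximalCurveFor v c I' X' T' Y' k' →
          LightCone.frameData v X' T' Y' 0 = p →
          I' = I ∧ ∃ M : Matrix (Fin 3) (Fin 3) ℝ, LightCone.IsConeIsometry M ∧
            M *ᵥ v = v ∧ ∀ s ∈ I, X' s = M *ᵥ X s) ∧
    -- properties of all non-trivial curves for `v` and `c`
    (∀ (I : Set ℝ) (X T Y : ℝ → LightCone.Mink3) (k : ℝ → ℝ),
      LightCone.IsMaximalCurveFor v c I X T Y k → ¬ LightCone.IsTrivialCurve I k →
        (LightCone.IsSelfSimilarCF I X ∧ (c = 0 → LightCone.IsSolitonCF I X)) ∧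
        (∀ s ∈ I, LightCone.frameData v X T Y s ∈ LightCone.parameterSurface v c) ∧
        -- `v`, hence the class of `X` (the causal type of `v`), is determined by `X` and `c`
        (∀ v' : LightCone.Mink3, LightCone.IsCurveFor v' c I X T Y k → v' = v) ∧
        {s | s ∈ I ∧ k s = 0}.encard ≤ 2 ∧
        LightCone.EndAlternative c k (atBot : Filter I) ∧
        LightCone.EndAlternative c k (atTop : Filter I) ∧
        ENat.card (ConnectedComponents (LightCone.regularSet I k)) ≤ 3 ∧
        ∀ s₀ ∈ LightCone.regularSet I k,
          LightCone.IsSelfSimilarICF (connectedComponentIn (LightCone.regularSet I k) s₀)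
            (fun s => -Y s)) := by
  refine ⟨⟨LightCone.parameterSurface_nonempty hv c,
    LightCone.isRegularSurface_parameterSurface hv c⟩, fun p hp => ?_, fun I X T Y k hmax htriv => ?_⟩
  · obtain ⟨X₀, T₀, Y₀, hF, h1, h2, h3⟩ := LightCone.exists_frame_of_mem_dataSurface hv hp.1
    obtain ⟨I, X, T, Y, h0, hmax, hX, hT, hY⟩ := LightCone.exists_maximal_frame v c hF
    have hdata : LightCone.frameData v X T Y 0 = p := by
      simp only [LightCone.frameData, hX, hT, hY, h1, h2, h3]
    refine ⟨I, X, T, Y, _, h0, hmax.isMaximalCurveFor, ?_, hdata, ?_⟩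
    · rintro ⟨κ, hκ⟩
      refine hmax.sol.isDataSolution.not_regular_of_const (e := κ - c)
        (fun s hs => by linarith [hκ s hs]) h0 ?_
      rw [hX, hT, hY, h1, h2, h3]
      exact hp.2
    · intro I' X' T' Y' k' h0' hmax' hdata'
      exact hmax.unique hmax'.isMaximalFrame h0 h0' (hdata'.trans hdata.symm)
  · have hm := hmax.isMaximalFrame
    have hk : ∀ s ∈ I, k s = c + LightCone.mink (T s) v := hmax.1.equation
    have hne : ¬ ∃ e, ∀ s ∈ I, LightCone.mink (T s) v = e := fun ⟨e, he⟩ =>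
      htriv ⟨c + e, fun s hs => by rw [hk s hs, he s hs]⟩
    have hz : {s | s ∈ I ∧ k s = 0}.encard ≤ 2 := by
      have h1 := hm.sol.isDataSolution.encard_zeros_le_two fun s hs => hm.sol.regular hne hs
      have h2 : {s | s ∈ I ∧ k s = 0} = {s | s ∈ I ∧ c + LightCone.mink (T s) v = 0} :=
        Set.ext fun s => and_congr_right fun hs => by rw [hk s hs]
      rwa [h2]
    exact ⟨hm.sol.isSelfSimilarCF,
      fun s hs => ⟨(hm.sol.frame s hs).data_mem hv, hm.sol.regular hne hs⟩,
      fun v' hv' => hm.sol.vector_unique hne fun s hs => by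
        linarith [hk s hs, hv'.equation s hs],
      hz, (hm.endAlternative_atBot hne).congr hk, (hm.endAlternative_atTop hne).congr hk,
      LightCone.card_components_le_three hm.sol.interval.ordConnected hz,
      fun s₀ hs₀ => hm.sol.isSelfSimilarICF hk hs₀⟩
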